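/- **Theorem 3 (high-probability bound for Robust TD learning).** *Markov reward process.* Let $\mathbb X$ be a finite state space, $\mathcal P$ a transition kernel on $\mathbb X$ which is irreducible and aperiodic with stationary distribution $\mu$, and suppose $\max_x\|\mathcal P^t(x,\cdot)-\mu\|_{\mathsf{TV}}\le m\zeta^t$ for all $t\ge1$, for some $m>0$, $\zeta\in(0,1)$. At time $t\ge 1$ and in state $X_t$ a random reward $R_t$ is received, whose conditional law given $X_t$ satisfies, for some $p\in(0,1]$ and $u_0\in(0,\infty)$, $\mathbb E[|R_t|^{1+p}\mid X_t]\le u_0$ and $\mathbb E[R_t\mid X_t]=r(X_t)\in[-1,1]$. For $\gamma\in[0,1)$ let $\mathcal V(x)=\mathbb E[\sum_{t\ge1}\gamma^{t-1}R_t\mid X_1=x]$ be the value function of the Markov reward process (that is, for $X_{t+1}\sim\mathcal P(X_t,\cdot)$). *Approximation.* Let $\Phi:\mathbb X\to\mathbb R^d$ with $\|\Phi(x)\|_2\le1$ for all $x$, $f_\Theta(x)=\langle\Theta,\Phi(x)\rangle$, $\rho>0$, and assume that $\mathcal V=f_{\Theta^\star}$ for some $\Theta^\star$ with $\|\Theta^\star\|_2\le\rho$.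 *IID sampling.* The data $(X_t,R_t,X_t')$, $t\ge1$, are independent over $t$, with $X_t\sim\mu$, $X_t'\sim\mathcal P(X_t,\cdot)$ given $X_t$, and $R_t$ the reward at time $t$ in state $X_t$. *Robust TD learning.* With step size $\eta>0$ and clipping radii $b_t$, start from $\Theta(1)$ with $\|\Theta(1)\|_2\le\rho$ (deterministic, or random and independent of the data), and for $t\ge1$ set $$\Theta(t+1)=\Pi\Big\{\Theta(t)+\eta\, g_t(\Theta(t))\,\mathbb 1\{\|g_t(\Theta(t))\|_2\le b_t\}\Big\},\qquad g_t(\Theta)=\big(R_t+\gamma f_\Theta(X_t')-f_\Theta(X_t)\big)\Phi(X_t),$$ where $\Pi$ is the Euclidean projection onto $\{\Theta:\|\Theta\|_2\le\rho\}$. Let $\bar\Theta(T)=\frac1T\sum_{t=1}^T\Theta(t)$. *Claim.* Let $u=\min\{(u_0^{1/(1+p)}+2\rho)^{1+p},\,u_0+2^{2p+3}\rho^{1+p}\}$, $\delta\in(0,1)$, $L_\delta=\log(4/\delta)$, $T\ge1$. With $$b_t=\Big(\frac{ut}{L_\delta}\Big)^{\frac1{1+p}},\qquad \eta=\frac{\sqrt2\,\rho\,L_\delta^{\frac{1-p}{2(1+p)}}}{(uT)^{\frac1{1+p}}},$$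 the following holds with probability at least $1-\delta$: $$\sum_{x\in\mathbb X}\mu(x)\big(\mathcal V(x)-\langle\bar\Theta(T),\Phi(x)\rangle\big)^2\le\frac{\rho\,u^{\frac1{1+p}}}{(1-\gamma)\,T^{\frac p{1+p}}}\Big(3L_\delta^{-\frac{1-p}{2(1+p)}}+7L_\delta^{\frac p{1+p}}\Big).$$ -/

import Mathlib

open MeasureTheory ProbabilityTheory

namespace RobustTD

noncomputable section

/-! ### Markov chains and Markov reward processes -/

section MarkovRewardProcess

variable {S : Type*} [MeasurableSpace S]

/-- Total variation distance of two probability measures. -/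
def tvDist (μ ν : Measure S) : ℝ :=
  ⨆ A : {A : Set S // MeasurableSet A}, |μ.real A.1 - ν.real A.1|

/-- Aperiodicity: for every state, `1` is the only common divisor of the possible return times. -/
def Aperiodic (P : Kernel S S) : Prop :=
  ∀ (x : S) (k : ℕ), (∀ n : ℕ, 1 ≤ n → 0 < (P ^ n) x {x} → k ∣ n) → k = 1

/-- Ergodicity: an irreducible and aperiodic chain with stationary distribution `μ`, whose
`t`-step laws converge to `μ` at a geometric rate, uniformly in the initial state. -/
structure IsErgodic (P : Kernel S S) (μ : Measure S) : Prop where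
  irreducible : Kernel.IsIrreducible Measure.count P
  aperiodic : Aperiodic P
  invariant : Kernel.Invariant P μ
  geometric : ∃ m ζ : ℝ, 0 < m ∧ 0 < ζ ∧ ζ < 1 ∧
    ∀ t : ℕ, 1 ≤ t → ∀ x : S, tvDist ((P ^ t) x) μ ≤ m * ζ ^ t

/-- Heavy-tailed rewards. Here `Q n x` is the conditional law of the reward `R_{n+1}` given
`X_{n+1} = x`: its absolute moment of order `1 + p` is at most `u₀`, and its mean is
`r x ∈ [-1, 1]`. -/
structure IsHeavyTailedReward (Q : ℕ → Kernel S ℝ) (p u₀ : ℝ) (r : S → ℝ) : Prop where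
  moment : ∀ n x, ∫⁻ v, ENNReal.ofReal (|v| ^ (1 + p)) ∂(Q n x) ≤ ENNReal.ofReal u₀
  mean : ∀ n x, ∫ v, v ∂(Q n x) = r x
  mean_mem : ∀ x, r x ∈ Set.Icc (-1 : ℝ) 1

/-- One step of the Markov reward process: given the history of state-reward pairs
`(X₁, R₁), …, (X_{n+1}, R_{n+1})`, draw `X_{n+2}` from `P(X_{n+1}, ·)` and then the
reward `R_{n+2}` from its conditional law given `X_{n+2}`. -/
def mrpStep (P : Kernel S S) (Q : ℕ → Kernel S ℝ) (n : ℕ) :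
    Kernel (Π _ : Finset.Iic n, S × ℝ) (S × ℝ) :=
  (P ⊗ₖ Kernel.prodMkLeft S (Q (n + 1))).comap
    (fun h => (h ⟨n, Finset.mem_Iic.2 le_rfl⟩).1) (by fun_prop)

instance (P : Kernel S S) [IsMarkovKernel P] (Q : ℕ → Kernel S ℝ) [∀ n, IsMarkovKernel (Q n)]
    (n : ℕ) : IsMarkovKernel (mrpStep P Q n) := by
  unfold mrpStep; infer_instance

/-- The law of the trajectory `(X_{n+1}, R_{n+1})_{n ≥ 0}` of the Markov reward process started
at `X₁ = x`. -/
def mrpLaw (P : Kernel S S) [IsMarkovKernel P] (Q : ℕ → Kernel S ℝ) [∀ n, IsMarkovKernel (Q n)]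
    (x : S) : Measure (ℕ → S × ℝ) :=
  Kernel.trajMeasure (X := fun _ => S × ℝ) (Measure.dirac x ⊗ₘ Q 0) (mrpStep P Q)

/-- The value function `𝒱(x) = 𝔼[∑_{t ≥ 1} γ^(t-1) R_t | X₁ = x]`. -/
def valueFun (P : Kernel S S) [IsMarkovKernel P] (Q : ℕ → Kernel S ℝ) [∀ n, IsMarkovKernel (Q n)]
    (γ : ℝ) (x : S) : ℝ :=
  ∫ ω, ∑' n : ℕ, γ ^ n * (ω n).2 ∂(mrpLaw P Q x)

/-- IID sampling. The `n`-th data point is `Z n = (X_t, R_t, X_t')` with `t = n + 1`. The data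
points are independent of each other and of the (possibly random) initial parameter `θ₁`;
`X_t` has law `μ`, and given `X_t`, the next state `X_t'` has law `P(X_t, ·)` and the reward
`R_t` has law `Q n X_t`. -/
structure IsIIDSampling {Ω E : Type*} [MeasurableSpace Ω] [MeasurableSpace E] (Pr : Measure Ω)
    (P : Kernel S S) (Q : ℕ → Kernel S ℝ) (μ : Measure S)
    (θ₁ : Ω → E) (Z : ℕ → Ω → S × ℝ × S) : Prop where
  measurable_init : Measurable θ₁
  measurable_data : ∀ n, Measurable (Z n)
  indep_data : iIndepFun Z Pr
  indep_init : IndepFun θ₁ (fun ω n => Z n ω) Pr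
  law_next : ∀ n, Pr.map (fun ω => ((Z n ω).1, (Z n ω).2.2)) = μ ⊗ₘ P
  law_reward : ∀ n, Pr.map (fun ω => ((Z n ω).1, (Z n ω).2.1)) = μ ⊗ₘ Q n

end MarkovRewardProcess

/-! ### Robust TD learning -/

section Algorithm

variable {S : Type*} {d : ℕ}

/-- The linear approximation `f_θ(x) = ⟨θ, Φ(x)⟩`. -/
def linApprox (Φ : S → EuclideanSpace ℝ (Fin d)) (θ : EuclideanSpace ℝ (Fin d)) (x : S) : ℝ :=
  inner ℝ θ (Φ x)

/-- The stochastic semi-gradient at `θ` for the data point `z = (x, r, x')`: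
`(r + γ f_θ(x') - f_θ(x)) ∇_θ f_θ(x)`. -/
def semiGrad (Φ : S → EuclideanSpace ℝ (Fin d)) (γ : ℝ) (z : S × ℝ × S)
    (θ : EuclideanSpace ℝ (Fin d)) : EuclideanSpace ℝ (Fin d) :=
  (z.2.1 + γ * linApprox Φ θ z.2.2 - linApprox Φ θ z.1) •
    gradient (fun θ' => linApprox Φ θ' z.1) θ

theorem gradient_linApprox (Φ : S → EuclideanSpace ℝ (Fin d)) (x : S)
    (θ : EuclideanSpace ℝ (Fin d)) : gradient (fun θ' => linApprox Φ θ' x) θ = Φ x := by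
  apply HasGradientAt.gradient
  rw [hasGradientAt_iff_hasFDerivAt]
  have h := (InnerProductSpace.toDual ℝ (EuclideanSpace ℝ (Fin d)) (Φ x)).hasFDerivAt (x := θ)
  refine h.congr_of_eventuallyEq (Filter.Eventually.of_forall fun y => ?_)
  simp [linApprox, real_inner_comm]

/-- The clipped vector `g · 𝟙{‖g‖ ≤ b}`. -/
def clip (b : ℝ) (g : EuclideanSpace ℝ (Fin d)) : EuclideanSpace ℝ (Fin d) :=
  if ‖g‖ ≤ b then g else 0

/-- Euclidean projection onto the closed ball of radius `ρ` centred at `0`. -/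
def projBall (ρ : ℝ) (z : EuclideanSpace ℝ (Fin d)) : EuclideanSpace ℝ (Fin d) :=
  if ‖z‖ ≤ ρ then z else (ρ / ‖z‖) • z

/-- `projBall ρ z` is a point of the ball that is closest to `z`. -/
theorem projBall_isMinOn {ρ : ℝ} (hρ : 0 ≤ ρ) (z : EuclideanSpace ℝ (Fin d)) :
    ‖projBall ρ z‖ ≤ ρ ∧
      ∀ y : EuclideanSpace ℝ (Fin d), ‖y‖ ≤ ρ → ‖z - projBall ρ z‖ ≤ ‖z - y‖ := by
  unfold projBall
  split_ifs with h
  · exact ⟨h, fun y _ => by simp⟩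
  · have hz : 0 < ‖z‖ := lt_of_le_of_lt hρ (not_le.1 h)
    have h1 : ρ / ‖z‖ ≤ 1 := (div_le_one hz).2 (not_le.1 h).le
    have h2 : 0 ≤ ρ / ‖z‖ := by positivity
    refine ⟨?_, fun y hy => ?_⟩
    · rw [norm_smul, Real.norm_of_nonneg h2, div_mul_cancel₀ _ hz.ne']
    · have h3 : z - (ρ / ‖z‖) • z = (1 - ρ / ‖z‖) • z := by rw [sub_smul, one_smul]
      rw [h3, norm_smul, Real.norm_of_nonneg (by linarith), sub_mul, div_mul_cancel₀ _ hz.ne']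
      linarith [norm_sub_norm_le z y]

/-- The iterates of robust TD learning, with constant step size `η`, clipping radii
`b 1, b 2, …`, projection radius `ρ`, initial parameter `θ₁` and data `z`:
`robustTD … n` is the iterate `Θ(n + 1)`, so that `Θ(1) = θ₁` and
`Θ(t+1) = Π{Θ(t) + η g_t(Θ(t)) 𝟙{‖g_t(Θ(t))‖ ≤ b_t}}`, where `g_t` uses the data point
`z n`, `t = n + 1`. -/
def robustTD (Φ : S → EuclideanSpace ℝ (Fin d)) (γ ρ η : ℝ) (b : ℕ → ℝ)
    (θ₁ : EuclideanSpace ℝ (Fin d)) (z : ℕ → S × ℝ × S) : ℕ → EuclideanSpace ℝ (Fin d)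
  | 0 => θ₁
  | n + 1 => projBall ρ (robustTD Φ γ ρ η b θ₁ z n +
      η • clip (b (n + 1)) (semiGrad Φ γ (z n) (robustTD Φ γ ρ η b θ₁ z n)))

/-- The averaged iterate `(1/T) ∑_{t=1}^T Θ(t)`. -/
def avgIterate (Φ : S → EuclideanSpace ℝ (Fin d)) (γ ρ η : ℝ) (b : ℕ → ℝ)
    (θ₁ : EuclideanSpace ℝ (Fin d)) (z : ℕ → S × ℝ × S) (T : ℕ) : EuclideanSpace ℝ (Fin d) :=
  (1 / (T : ℝ)) • ∑ n ∈ Finset.range T, robustTD Φ γ ρ η b θ₁ z n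

end Algorithm

/-! ### Parameters -/

/-- `u = min {(u₀^(1/(1+p)) + 2ρ)^(1+p), u₀ + 2^(2p+3) ρ^(1+p)}`. -/
def gradMoment (p u₀ ρ : ℝ) : ℝ :=
  min ((u₀ ^ (1 / (1 + p)) + 2 * ρ) ^ (1 + p)) (u₀ + 2 ^ (2 * p + 3) * ρ ^ (1 + p))

/-- `L_δ = log (4/δ)`. -/
def logTerm (δ : ℝ) : ℝ := Real.log (4 / δ)

/-- The clipping radius `b_t = (u t / L)^(1/(1+p))`. -/
def clipRadius (p u L : ℝ) (t : ℕ) : ℝ := (u * t / L) ^ (1 / (1 + p))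

/-- The step size `√2 ρ L^((1-p)/(2(1+p))) / (u T)^(1/(1+p))`. -/
def stepSize (p u L ρ : ℝ) (T : ℕ) : ℝ :=
  √2 * ρ * L ^ ((1 - p) / (2 * (1 + p))) / (u * T) ^ (1 / (1 + p))

end

end RobustTD

namespace RobustTD

/-! ### Value function: time marginals of the reward process and the Bellman equation. -/

section ValueFunction

variable {S : Type*} [MeasurableSpace S]

/-! Write `h = V - f_θ`, where `V` is the value function. By the Bellman equation the mean of
`⟨g(θ), θ* - θ⟩` is `∫ (h - γ P h) h ∂μ`, and stationarity makes this at least `(1 - γ) ∫ h² ∂μ`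
(`drift_le_integral_inner_semiGrad`). Projected steps with the clipped vectors `c_t` satisfy the
pathwise regret bound `∑ ⟨c_t, θ* - Θ(t)⟩ ≤ 2ρ²/η + (η/2) ∑ ‖c_t‖²` (`sum_inner_clip_le`). It
remains to control, with high probability, the gap between the drifts and these inner products, and
the sum of the `‖c_t‖²`.

Both are sums of functions of `Θ(t)` and the fresh data point, which is independent of `Θ(t)`.
Bounds on their one-step exponential moments therefore multiply, and Markov's inequality gives tails
(`measure_sum_recursion_gt_le`). With `B = b_T`, the gap is tested at scale `1/(2ρB)`, where every
exponent from the clipped inner product is at most `1` in absolute value. Clipping bias and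
quadratic remainder are then paid for together by a single moment of order `1 + p`, because the
vector is either kept or discarded (`norm_sub_clip_add_sq_le`, `lintegral_exp_inner_clip_le`). For
`‖c_t‖²/B² ∈ [0, 1]` the chord of the exponential suffices (`lintegral_exp_sq_norm_clip_le`).

The moment is at most `(9/8) u`, a factor that the final constants absorb. Each event fails with
probability at most `δ/2`; on the rest, the parameter identities and Jensen's inequality for the
averaged iterate give the bound. -/

theorem isMarkovKernel_pow (P : Kernel S S) [IsMarkovKernel P] (n : ℕ) :
    IsMarkovKernel (P ^ n) := by
  induction n with
  | zero => rw [pow_zero]; exact inferInstanceAs (IsMarkovKernel Kernel.id)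
  | succ n ih =>
    rw [pow_succ']
    exact inferInstanceAs (IsMarkovKernel (P ∘ₖ (P ^ n : Kernel S S)))

instance (P : Kernel S S) [IsMarkovKernel P] (Q : ℕ → Kernel S ℝ) [∀ n, IsMarkovKernel (Q n)]
    (x : S) : IsProbabilityMeasure (mrpLaw P Q x) := by
  unfold mrpLaw; infer_instance

theorem map_eval_zero_trajMeasure {E : Type*} [MeasurableSpace E]
    (μ₀ : Measure E) [IsProbabilityMeasure μ₀]
    (κ : (n : ℕ) → Kernel (Π _ : Finset.Iic n, E) E) [∀ n, IsMarkovKernel (κ n)] :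
    (Kernel.trajMeasure (X := fun _ => E) μ₀ κ).map (fun ω => ω 0) = μ₀ := by
  have h : (fun ω : ℕ → E => ω 0) =
      (fun y : Π _ : Finset.Iic 0, E => y ⟨0, by simp⟩) ∘
        Preorder.frestrictLe (π := fun _ => E) 0 := rfl
  rw [h, ← Measure.map_map (by fun_prop) (by fun_prop), Kernel.trajMeasure,
    Measure.map_comp _ _ (by fun_prop), Kernel.traj_map_frestrictLe, Kernel.partialTraj_self,
    Measure.id_comp]
  refine (Measure.map_map (by fun_prop) (MeasurableEquiv.measurable _)).trans ?_
  convert! Measure.map_id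

/-- The second kernel ignores the initial point, so that point can be integrated out first. This is
what keeps the law of a state-reward pair of the form "state marginal, then reward" along the chain.
-/
theorem compProd_prodMkLeft_comp {α β : Type*} [MeasurableSpace α] [MeasurableSpace β]
    (μ : Measure S) [SFinite μ] (κ : Kernel S α) [IsSFiniteKernel κ]
    (η : Kernel α β) [IsSFiniteKernel η] :
    (κ ⊗ₖ Kernel.prodMkLeft S η) ∘ₘ μ = (κ ∘ₘ μ) ⊗ₘ η := by
  ext s hs
  rw [Measure.bind_apply hs (by fun_prop), Measure.compProd_apply hs,
    Measure.lintegral_bind (by fun_prop) (by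
      exact (Kernel.measurable_kernel_prodMk_left hs).aemeasurable)]
  refine lintegral_congr fun a => ?_
  rw [Kernel.compProd_apply hs]
  rfl

/-- Induction on time: a step reads only the last state of the history, so the state marginal at
time `n` determines the law of the next pair. -/
theorem map_eval_mrpLaw (P : Kernel S S) [IsMarkovKernel P] (Q : ℕ → Kernel S ℝ)
    [∀ n, IsMarkovKernel (Q n)] (x : S) (n : ℕ) :
    (mrpLaw P Q x).map (fun ω => ω n) = ((P ^ n) x) ⊗ₘ Q n := by
  have hP := isMarkovKernel_pow P
  induction n with
  | zero =>
    rw [mrpLaw, map_eval_zero_trajMeasure, pow_zero]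
    congr 1
  | succ n ih =>
    have hstep := Kernel.map_frestrictLe_trajMeasure_compProd_eq_map_trajMeasure
      (X := fun _ => S × ℝ) (μ₀ := Measure.dirac x ⊗ₘ Q 0) (κ := mrpStep P Q) (a := n)
    have h1 : (mrpLaw P Q x).map (fun ω => ω (n + 1)) =
        mrpStep P Q n ∘ₘ ((mrpLaw P Q x).map (Preorder.frestrictLe n)) := by
      rw [← Measure.snd_compProd]
      unfold mrpLaw
      rw [hstep, Measure.snd, Measure.map_map (by fun_prop) (by fun_prop)]
      rfl
    rw [h1, mrpStep, ← Kernel.comp_deterministic_eq_comap, ← Measure.comp_assoc,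
      Measure.deterministic_comp_eq_map, Measure.map_map (by fun_prop) (by fun_prop)]
    have h2 : (mrpLaw P Q x).map
        ((fun h : Π _ : Finset.Iic n, S × ℝ => (h ⟨n, Finset.mem_Iic.2 le_rfl⟩).1) ∘
          Preorder.frestrictLe n) = (P ^ n) x := by
      have : ((fun h : Π _ : Finset.Iic n, S × ℝ => (h ⟨n, Finset.mem_Iic.2 le_rfl⟩).1) ∘
          Preorder.frestrictLe n) = Prod.fst ∘ (fun ω : ℕ → S × ℝ => ω n) := rfl
      rw [this, ← Measure.map_map (by fun_prop) (by fun_prop), ih]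
      exact Measure.fst_compProd _ _
    rw [h2, compProd_prodMkLeft_comp, pow_succ']
    rfl

/-- A heavy-tailed reward has finite first absolute moment. -/
theorem IsHeavyTailedReward.lintegral_enorm_le {Q : ℕ → Kernel S ℝ} [∀ n, IsMarkovKernel (Q n)]
    {p u₀ : ℝ} {r : S → ℝ} (hQ : IsHeavyTailedReward Q p u₀ r) (hp : 0 ≤ p) (n : ℕ) (x : S) :
    ∫⁻ v, ‖v‖ₑ ∂(Q n x) ≤ 1 + ENNReal.ofReal u₀ := by
  calc ∫⁻ v, ‖v‖ₑ ∂(Q n x) ≤ ∫⁻ v, (1 + ENNReal.ofReal (|v| ^ (1 + p))) ∂(Q n x) := by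
        refine lintegral_mono fun v => ?_
        rw [← ofReal_norm, ← ENNReal.ofReal_one,
          ← ENNReal.ofReal_add zero_le_one (by positivity)]
        refine ENNReal.ofReal_le_ofReal ?_
        rw [Real.norm_eq_abs]
        rcases le_total |v| 1 with h | h
        · have : 0 ≤ |v| ^ (1 + p) := by positivity
          linarith
        · have := Real.rpow_le_rpow_of_exponent_le h (by linarith : (1 : ℝ) ≤ 1 + p)
          rw [Real.rpow_one] at this
          linarith
    _ ≤ 1 + ENNReal.ofReal u₀ := by
        rw [lintegral_add_left measurable_const]
        simpa using hQ.moment n x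

theorem lintegral_compProd_le {μ : Measure S} [IsProbabilityMeasure μ] {κ : Kernel S ℝ}
    [IsSFiniteKernel κ] {f : ℝ → ENNReal} (hf : Measurable f) {C : ENNReal}
    (h : ∀ x, ∫⁻ v, f v ∂(κ x) ≤ C) : ∫⁻ z, f z.2 ∂(μ ⊗ₘ κ) ≤ C := by
  rw [Measure.lintegral_compProd (by fun_prop)]
  calc _ ≤ ∫⁻ _, C ∂μ := lintegral_mono h
    _ = C := by simp

/-- If `X` has any law and `R` is the reward in state `X`, then `R` is integrable. -/
theorem IsHeavyTailedReward.integrable_compProd {Q : ℕ → Kernel S ℝ} [∀ n, IsMarkovKernel (Q n)]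
    {p u₀ : ℝ} {r : S → ℝ} (hQ : IsHeavyTailedReward Q p u₀ r) (hp : 0 ≤ p) (n : ℕ)
    (μ : Measure S) [IsProbabilityMeasure μ] :
    Integrable (fun z : S × ℝ => z.2) (μ ⊗ₘ Q n) ∧
    ∫⁻ z : S × ℝ, ‖z.2‖ₑ ∂(μ ⊗ₘ Q n) ≤ 1 + ENNReal.ofReal u₀ := by
  have h := lintegral_compProd_le (μ := μ) (κ := Q n) (f := fun v => ‖v‖ₑ) (by fun_prop)
    (hQ.lintegral_enorm_le hp n)
  exact ⟨⟨by fun_prop, h.trans_lt (by simp)⟩, h⟩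

/-- The first absolute moments of the rewards are bounded uniformly in time, so discounting
dominates the series geometrically and sum and expectation may be exchanged. -/
theorem valueFun_eq_tsum (P : Kernel S S) [IsMarkovKernel P] (Q : ℕ → Kernel S ℝ)
    [∀ n, IsMarkovKernel (Q n)] {γ p u₀ : ℝ} (hγ : γ ∈ Set.Ico (0 : ℝ) 1) (hp : 0 ≤ p)
    {r : S → ℝ} (hQ : IsHeavyTailedReward Q p u₀ r) (x : S) :
    valueFun P Q γ x = ∑' n : ℕ, γ ^ n * ∫ y, r y ∂((P ^ n) x) := by
  have hP := isMarkovKernel_pow P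
  have hR : ∀ n, Integrable (fun ω : ℕ → S × ℝ => (ω n).2) (mrpLaw P Q x) ∧
      ∫ ω, ‖(ω n).2‖ ∂(mrpLaw P Q x) ≤ (1 + ENNReal.ofReal u₀).toReal ∧
      ∫ ω, (ω n).2 ∂(mrpLaw P Q x) = ∫ y, r y ∂((P ^ n) x) := by
    intro n
    obtain ⟨hi, hle⟩ := hQ.integrable_compProd hp n ((P ^ n) x)
    have hmap := map_eval_mrpLaw P Q x n
    rw [← hmap] at hi hle
    have hi' : Integrable (fun ω : ℕ → S × ℝ => (ω n).2) (mrpLaw P Q x) := hi.comp_measurable (measurable_pi_apply n)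
    refine ⟨hi', ?_, ?_⟩
    · rw [integral_norm_eq_lintegral_enorm hi'.1]
      refine ENNReal.toReal_mono (by simp) ?_
      rwa [lintegral_map (by fun_prop) (by fun_prop)] at hle
    · rw [hmap] at hi
      have := integral_map (μ := mrpLaw P Q x) (φ := fun ω => ω n)
        (f := fun z : S × ℝ => z.2) (measurable_pi_apply n).aemeasurable (by fun_prop)
      rw [← this, hmap, Measure.integral_compProd hi]
      exact integral_congr_ae (Filter.Eventually.of_forall fun y => hQ.mean n y)
  rw [valueFun, ← integral_tsum_of_summable_integral_norm
    (F := fun n (ω : ℕ → S × ℝ) => γ ^ n * (ω n).2) (fun n => (hR n).1.const_mul _)]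
  · refine tsum_congr fun n => ?_
    rw [integral_const_mul, (hR n).2.2]
  · refine Summable.of_nonneg_of_le (fun n => integral_nonneg fun _ => norm_nonneg _) (fun n => ?_)
      ((summable_geometric_of_lt_one hγ.1 hγ.2).mul_right (1 + ENNReal.ofReal u₀).toReal)
    simp_rw [norm_mul, norm_pow, Real.norm_of_nonneg hγ.1]
    rw [integral_const_mul]
    exact mul_le_mul_of_nonneg_left (hR n).2.1 (pow_nonneg hγ.1 _)

/-- The Bellman equation. -/
theorem valueFun_bellman [Finite S] [MeasurableSingletonClass S]
    (P : Kernel S S) [IsMarkovKernel P] (Q : ℕ → Kernel S ℝ)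
    [∀ n, IsMarkovKernel (Q n)] {γ p u₀ : ℝ} (hγ : γ ∈ Set.Ico (0 : ℝ) 1) (hp : 0 ≤ p)
    {r : S → ℝ} (hQ : IsHeavyTailedReward Q p u₀ r) (x : S) :
    valueFun P Q γ x = r x + γ * ∫ y, valueFun P Q γ y ∂(P x) := by
  have hP := isMarkovKernel_pow P
  have hr : ∀ (ν : Measure S) [IsProbabilityMeasure ν], ‖∫ y, r y ∂ν‖ ≤ 1 := fun ν _ =>
    (norm_integral_le_of_norm_le_const (C := 1) (Filter.Eventually.of_forall fun y =>
      abs_le.2 (hQ.mean_mem y))).trans (by simp)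
  have hb : ∀ y n, ‖γ ^ n * ∫ z, r z ∂((P ^ n) y)‖ ≤ γ ^ n := fun y n => by
    rw [norm_mul, norm_pow, Real.norm_of_nonneg hγ.1]
    exact mul_le_of_le_one_right (pow_nonneg hγ.1 _) (hr _)
  have hs : ∀ y, Summable fun n => γ ^ n * ∫ z, r z ∂((P ^ n) y) := fun y =>
    Summable.of_norm_bounded (summable_geometric_of_lt_one hγ.1 hγ.2) (hb y)
  have hfin : ∀ (f : S → ℝ) (ν : Measure S) [IsFiniteMeasure ν], Integrable f ν :=
    fun f ν _ => Integrable.of_finite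
  simp_rw [valueFun_eq_tsum P Q hγ hp hQ]
  rw [(hs x).tsum_eq_zero_add, ← integral_tsum_of_summable_integral_norm (fun n => hfin _ _)]
  · congr 1
    · simp only [pow_zero, one_mul]
      exact integral_dirac r x
    · rw [← tsum_mul_left]
      refine tsum_congr fun n => ?_
      -- In `P ^ n * P` the right factor acts first, so this isolates the first transition out of
      -- `x`.
      rw [integral_const_mul, pow_succ γ, pow_succ P]
      have : ∫ z, r z ∂((P ^ n * P) x) = ∫ y, ∫ z, r z ∂((P ^ n) y) ∂(P x) :=
        Kernel.integral_comp (η := P ^ n) (κ := P) (a := x) (hfin r _)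
      rw [this]
      ring
  · refine Summable.of_nonneg_of_le (fun n => integral_nonneg fun _ => norm_nonneg _) (fun n => ?_)
      (summable_geometric_of_lt_one hγ.1 hγ.2)
    calc _ ≤ ∫ _, γ ^ n ∂(P x) := integral_mono (hfin _ _) (hfin _ _) fun y => hb y n
      _ = γ ^ n := by simp

end ValueFunction

/-! ### The moment constant and weighted power means. -/

section Moments

/-- Convexity of `t ↦ t ^ q` at `x + y = (1 - s) (x / (1 - s)) + s (y / s)`. The free weight `s`
lets one pointwise inequality serve both bounds in `gradMoment`. -/
theorem rpow_add_le_weighted {x y s q : ℝ} (hx : 0 ≤ x) (hy : 0 ≤ y) (hs : 0 < s) (hs1 : s < 1)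
    (hq : 1 ≤ q) : (x + y) ^ q ≤ (1 - s) ^ (1 - q) * x ^ q + s ^ (1 - q) * y ^ q := by
  have hs' : 0 < 1 - s := by linarith
  have h := (convexOn_rpow hq).2 (x := x / (1 - s)) (y := y / s) (Set.mem_Ici.2 (by positivity))
    (Set.mem_Ici.2 (by positivity)) hs'.le hs.le (by ring)
  simp only [smul_eq_mul] at h
  rw [mul_div_cancel₀ _ hs'.ne', mul_div_cancel₀ _ hs.ne', Real.div_rpow hx hs'.le,
    Real.div_rpow hy hs.le] at h
  rw [Real.rpow_sub hs', Real.rpow_sub hs, Real.rpow_one, Real.rpow_one]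
  refine h.trans_eq ?_
  ring

theorem gradMoment_pos {p u₀ ρ : ℝ} (hu₀ : 0 < u₀) (hρ : 0 < ρ) : 0 < gradMoment p u₀ ρ := by
  unfold gradMoment
  exact lt_min (by positivity) (by positivity)

/-- Both bounds in `gradMoment` arise, up to the factor `9 / 8`, from a weighted power mean
inequality. -/
theorem exists_weight_le_gradMoment {p u₀ ρ : ℝ} (hp : p ∈ Set.Ioc (0 : ℝ) 1) (hu₀ : 0 < u₀)
    (hρ : 0 < ρ) : ∃ s : ℝ, 0 < s ∧ s < 1 ∧
      (1 - s) ^ (-p) * u₀ + s ^ (-p) * (2 * ρ) ^ (1 + p) ≤ 9 / 8 * gradMoment p u₀ ρ := by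
  obtain ⟨hp0, hp1⟩ := hp
  rcases min_choice ((u₀ ^ (1 / (1 + p)) + 2 * ρ) ^ (1 + p)) (u₀ + 2 ^ (2 * p + 3) * ρ ^ (1 + p))
    with h | h
  · set a := u₀ ^ (1 / (1 + p)) with ha
    have ha0 : 0 < a := by positivity
    have hau : u₀ = a ^ (1 + p) := by
      rw [ha, ← Real.rpow_mul hu₀.le, one_div_mul_cancel (by positivity), Real.rpow_one]
    -- This weight gives exactly the Minkowski bound `(a + 2ρ) ^ (1 + p)`, without the factor `9/8`.
    refine ⟨2 * ρ / (a + 2 * ρ), by positivity, (div_lt_one (by positivity)).2 (by linarith), ?_⟩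
    have h1 : 1 - 2 * ρ / (a + 2 * ρ) = a / (a + 2 * ρ) := by field_simp; ring
    have key : ∀ y : ℝ, 0 < y → (y / (a + 2 * ρ)) ^ (-p) * y ^ (1 + p) = (a + 2 * ρ) ^ p * y := by
      intro y hy
      rw [Real.div_rpow hy.le (by positivity), Real.rpow_neg hy.le, Real.rpow_neg (by positivity),
        Real.rpow_add hy, Real.rpow_one]
      have : 0 < y ^ p := by positivity
      field_simp
    rw [gradMoment, h, h1, key _ (by positivity)]
    rw [show (a / (a + 2 * ρ)) ^ (-p) * u₀ = (a / (a + 2 * ρ)) ^ (-p) * a ^ (1 + p) by rw [← hau],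
      key _ ha0]
    have h2 : (a + 2 * ρ) ^ (1 + p) = (a + 2 * ρ) ^ p * a + (a + 2 * ρ) ^ p * (2 * ρ) := by
      rw [Real.rpow_add (by positivity), Real.rpow_one]; ring
    have h3 : 0 < (a + 2 * ρ) ^ (1 + p) := by positivity
    rw [← h2]
    linarith
  -- With `s = 1/9` the coefficients are `(9/8) ^ p ≤ 9/8` and `9 ^ p * 2 ^ (1 + p) ≤ 9 * 4 ^ p =
  -- (9/8) * 2 ^ (2p + 3)`, both sharp at `p = 1`.
  · refine ⟨1 / 9, by norm_num, by norm_num, ?_⟩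
    rw [gradMoment, h]
    have h1 : (1 - 1 / 9 : ℝ) ^ (-p) ≤ 9 / 8 := by
      rw [Real.rpow_neg (by norm_num), ← Real.inv_rpow (by norm_num)]
      calc ((1 - 1 / 9 : ℝ)⁻¹) ^ p = (9 / 8 : ℝ) ^ p := by norm_num
        _ ≤ (9 / 8 : ℝ) ^ (1 : ℝ) := Real.rpow_le_rpow_of_exponent_le (by norm_num) hp1
        _ = 9 / 8 := Real.rpow_one _
    have h2 : (1 / 9 : ℝ) ^ (-p) * (2 * ρ) ^ (1 + p) ≤ 9 / 8 * (2 ^ (2 * p + 3) * ρ ^ (1 + p)) := by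
      rw [Real.mul_rpow (by norm_num) hρ.le, ← mul_assoc, ← mul_assoc]
      refine mul_le_mul_of_nonneg_right ?_ (by positivity)
      rw [one_div, Real.rpow_neg (by norm_num), ← Real.inv_rpow (by norm_num), inv_inv,
        Real.rpow_add two_pos, Real.rpow_add two_pos, Real.rpow_one, mul_comm 2 p,
        Real.rpow_mul zero_le_two]
      have h3 : ((2 : ℝ) ^ p) ^ (2 : ℝ) = 2 ^ p * 2 ^ p := by
        rw [Real.rpow_two, sq]
      have h4 : (9 / 2 : ℝ) ^ p ≤ 9 / 2 := by
        calc (9 / 2 : ℝ) ^ p ≤ (9 / 2 : ℝ) ^ (1 : ℝ) :=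
              Real.rpow_le_rpow_of_exponent_le (by norm_num) hp1
          _ = 9 / 2 := Real.rpow_one _
      have h5 : (9 : ℝ) ^ p = (9 / 2 : ℝ) ^ p * 2 ^ p := by
        rw [← Real.mul_rpow (by norm_num) (by norm_num)]; norm_num
      have h6 : 0 < (2 : ℝ) ^ p := by positivity
      have h8 : (2 : ℝ) ^ (3 : ℝ) = 8 := by norm_num
      rw [h3, h5, h8]
      nlinarith [mul_le_mul_of_nonneg_right h4 (mul_pos h6 h6).le]
    nlinarith [mul_le_mul_of_nonneg_right h1 hu₀.le]

end Moments

/-! ### Semi-gradient: moment bound and drift. -/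

section Gradient

variable {S : Type*} {d : ℕ}

theorem abs_linApprox_le {Φ : S → EuclideanSpace ℝ (Fin d)} (hΦ : ∀ x, ‖Φ x‖ ≤ 1) {ρ : ℝ}
    {θ : EuclideanSpace ℝ (Fin d)} (hθ : ‖θ‖ ≤ ρ) (x : S) : |linApprox Φ θ x| ≤ ρ := by
  refine (abs_real_inner_le_norm θ (Φ x)).trans ?_
  nlinarith [hΦ x, norm_nonneg θ, norm_nonneg (Φ x)]

theorem norm_semiGrad_le {Φ : S → EuclideanSpace ℝ (Fin d)} (hΦ : ∀ x, ‖Φ x‖ ≤ 1) {ρ γ : ℝ}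
    (hγ : γ ∈ Set.Ico (0 : ℝ) 1) {θ : EuclideanSpace ℝ (Fin d)} (hθ : ‖θ‖ ≤ ρ)
    (z : S × ℝ × S) : ‖semiGrad Φ γ z θ‖ ≤ |z.2.1| + 2 * ρ := by
  rw [semiGrad, gradient_linApprox, norm_smul, Real.norm_eq_abs]
  have h1 : |z.2.1 + γ * linApprox Φ θ z.2.2 - linApprox Φ θ z.1| ≤ |z.2.1| + 2 * ρ := by
    have a1 := abs_linApprox_le hΦ hθ z.1
    have a2 := abs_linApprox_le hΦ hθ z.2.2
    have a3 : |γ * linApprox Φ θ z.2.2| ≤ ρ := by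
      rw [abs_mul, abs_of_nonneg hγ.1]
      nlinarith [abs_nonneg (linApprox Φ θ z.2.2), hγ.2, hγ.1]
    calc _ ≤ |z.2.1 + γ * linApprox Φ θ z.2.2| + |linApprox Φ θ z.1| := abs_sub _ _
      _ ≤ |z.2.1| + |γ * linApprox Φ θ z.2.2| + |linApprox Φ θ z.1| := by
        gcongr; exact abs_add_le _ _
      _ ≤ _ := by linarith
  calc _ ≤ (|z.2.1| + 2 * ρ) * 1 := mul_le_mul h1 (hΦ _) (norm_nonneg _) ((abs_nonneg _).trans h1)
    _ = _ := mul_one _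

variable [MeasurableSpace S] [DiscreteMeasurableSpace S]

theorem measurable_semiGrad (Φ : S → EuclideanSpace ℝ (Fin d)) (γ : ℝ) :
    Measurable fun q : EuclideanSpace ℝ (Fin d) × (S × ℝ × S) => semiGrad Φ γ q.2 q.1 := by
  simp only [semiGrad, gradient_linApprox]
  simp only [linApprox]
  have hΦ : Measurable Φ := .of_discrete
  fun_prop

theorem measurable_clip (b : ℝ) : Measurable (clip (d := d) b) :=
  Measurable.ite (measurableSet_le measurable_norm measurable_const) measurable_id measurable_const

theorem measurable_projBall (ρ : ℝ) : Measurable (projBall (d := d) ρ) :=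
  Measurable.ite (measurableSet_le measurable_norm measurable_const) measurable_id
    ((measurable_const.div measurable_norm).smul measurable_id)

/-- The moment bound of order `1 + p` for the semi-gradient. It needs no assumption on the joint
law of the reward and the next state. -/
theorem integral_norm_semiGrad_rpow_le {Φ : S → EuclideanSpace ℝ (Fin d)} (hΦ : ∀ x, ‖Φ x‖ ≤ 1)
    {ρ γ p u₀ : ℝ} (hγ : γ ∈ Set.Ico (0 : ℝ) 1) (hp : p ∈ Set.Ioc (0 : ℝ) 1) (hu₀ : 0 < u₀)
    (hρ : 0 < ρ) {Q : ℕ → Kernel S ℝ} [∀ n, IsMarkovKernel (Q n)] {r : S → ℝ}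
    (hQ : IsHeavyTailedReward Q p u₀ r) {μ : Measure S} [IsProbabilityMeasure μ] {n : ℕ}
    {ν : Measure (S × ℝ × S)} [IsProbabilityMeasure ν]
    (hν : ν.map (fun z => (z.1, z.2.1)) = μ ⊗ₘ Q n)
    {θ : EuclideanSpace ℝ (Fin d)} (hθ : ‖θ‖ ≤ ρ) :
    Integrable (fun z => ‖semiGrad Φ γ z θ‖ ^ (1 + p)) ν ∧
      ∫ z, ‖semiGrad Φ γ z θ‖ ^ (1 + p) ∂ν ≤ 9 / 8 * gradMoment p u₀ ρ := by
  have hp0 := hp.1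
  have hR : ∫⁻ z, ENNReal.ofReal (|z.2.1| ^ (1 + p)) ∂ν ≤ ENNReal.ofReal u₀ := by
    have := lintegral_compProd_le (μ := μ) (κ := Q n)
      (f := fun v => ENNReal.ofReal (|v| ^ (1 + p))) (by fun_prop) (hQ.moment n)
    rwa [← hν, lintegral_map (by fun_prop) (by fun_prop)] at this
  obtain ⟨s, hs, hs1, hsu⟩ := exists_weight_le_gradMoment hp hu₀ hρ
  have hs1' : 0 < 1 - s := by linarith
  have hpt : ∀ z : S × ℝ × S, ‖semiGrad Φ γ z θ‖ ^ (1 + p) ≤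
      (1 - s) ^ (-p) * |z.2.1| ^ (1 + p) + s ^ (-p) * (2 * ρ) ^ (1 + p) := by
    intro z
    refine (Real.rpow_le_rpow (norm_nonneg _) (norm_semiGrad_le hΦ hγ hθ z) (by linarith)).trans ?_
    have := rpow_add_le_weighted (abs_nonneg z.2.1) (by positivity : 0 ≤ 2 * ρ) hs hs1
      (by linarith : 1 ≤ 1 + p)
    rwa [show 1 - (1 + p) = -p by ring] at this
  have hmeas : Measurable fun z => semiGrad Φ γ z θ :=
    (measurable_semiGrad Φ γ).comp (by fun_prop : Measurable fun z => (θ, z))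
  have hle : ∫⁻ z, ENNReal.ofReal (‖semiGrad Φ γ z θ‖ ^ (1 + p)) ∂ν ≤
      ENNReal.ofReal (9 / 8 * gradMoment p u₀ ρ) := by
    calc _ ≤ ∫⁻ z, (ENNReal.ofReal ((1 - s) ^ (-p)) * ENNReal.ofReal (|z.2.1| ^ (1 + p)) +
          ENNReal.ofReal (s ^ (-p) * (2 * ρ) ^ (1 + p))) ∂ν := by
          refine lintegral_mono fun z => ?_
          rw [← ENNReal.ofReal_mul (by positivity),
            ← ENNReal.ofReal_add (by positivity) (by positivity)]
          exact ENNReal.ofReal_le_ofReal (hpt z)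
      _ = ENNReal.ofReal ((1 - s) ^ (-p)) * ∫⁻ z, ENNReal.ofReal (|z.2.1| ^ (1 + p)) ∂ν +
          ENNReal.ofReal (s ^ (-p) * (2 * ρ) ^ (1 + p)) := by
          rw [lintegral_add_right _ measurable_const, lintegral_const_mul _ (by fun_prop)]
          simp
      _ ≤ ENNReal.ofReal ((1 - s) ^ (-p)) * ENNReal.ofReal u₀ +
          ENNReal.ofReal (s ^ (-p) * (2 * ρ) ^ (1 + p)) := by gcongr
      _ ≤ _ := by
          rw [← ENNReal.ofReal_mul (by positivity),
            ← ENNReal.ofReal_add (by positivity) (by positivity)]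
          exact ENNReal.ofReal_le_ofReal hsu
  have hm : Measurable fun z => ‖semiGrad Φ γ z θ‖ ^ (1 + p) := hmeas.norm.pow_const _
  have h0 : 0 ≤ᵐ[ν] fun z => ‖semiGrad Φ γ z θ‖ ^ (1 + p) :=
    Filter.Eventually.of_forall fun z => by positivity
  refine ⟨⟨hm.aestronglyMeasurable, ?_⟩, ?_⟩
  · rw [hasFiniteIntegral_iff_ofReal h0]
    exact hle.trans_lt ENNReal.ofReal_lt_top
  · rw [integral_eq_lintegral_of_nonneg_ae h0 hm.aestronglyMeasurable]
    exact ENNReal.toReal_le_of_le_ofReal (by have := gradMoment_pos (p := p) hu₀ hρ; positivity) hle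

/-- The mean semi-gradient points towards the true parameter. -/
theorem drift_le_integral_inner_semiGrad [Finite S]
    {Φ : S → EuclideanSpace ℝ (Fin d)}
    {γ p u₀ : ℝ} (hγ : γ ∈ Set.Ico (0 : ℝ) 1) (hp : 0 ≤ p)
    {P : Kernel S S} [IsMarkovKernel P]
    {Q : ℕ → Kernel S ℝ} [∀ n, IsMarkovKernel (Q n)] {r : S → ℝ}
    (hQ : IsHeavyTailedReward Q p u₀ r) {μ : Measure S} [IsProbabilityMeasure μ]
    (hμ : Kernel.Invariant P μ) {n : ℕ}
    {ν : Measure (S × ℝ × S)} [IsProbabilityMeasure ν]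
    (hν : ν.map (fun z => (z.1, z.2.1)) = μ ⊗ₘ Q n)
    (hν' : ν.map (fun z => (z.1, z.2.2)) = μ ⊗ₘ P)
    {θs : EuclideanSpace ℝ (Fin d)} (hθs : ∀ x, valueFun P Q γ x = linApprox Φ θs x)
    (θ : EuclideanSpace ℝ (Fin d)) :
    Integrable (fun z => inner ℝ (semiGrad Φ γ z θ) (θs - θ)) ν ∧
    (1 - γ) * ∫ x, (valueFun P Q γ x - linApprox Φ θ x) ^ 2 ∂μ ≤
      ∫ z, inner ℝ (semiGrad Φ γ z θ) (θs - θ) ∂ν := by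
  set V := valueFun P Q γ with hV
  set f := linApprox Φ θ with hf
  obtain ⟨h, hh⟩ : ∃ h : S → ℝ, ∀ x, h x = V x - f x := ⟨_, fun _ => rfl⟩
  have hfin : ∀ {α : Type _} [MeasurableSpace α] [Finite α] [DiscreteMeasurableSpace α]
      (f : α → ℝ) (ν : Measure α) [IsFiniteMeasure ν], Integrable f ν :=
    fun f ν _ => Integrable.of_finite
  have hd : ∀ f : S → ℝ, Measurable f := fun f => .of_discrete
  have hm : ∀ {α : Type _} [MeasurableSpace α] [DiscreteMeasurableSpace α] (f : α → ℝ),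
    Measurable f := fun f => .of_discrete
  have hpt : ∀ z : S × ℝ × S, inner ℝ (semiGrad Φ γ z θ) (θs - θ) =
      z.2.1 * h z.1 + (γ * f z.2.2 - f z.1) * h z.1 := by
    intro z
    have : inner ℝ (Φ z.1) (θs - θ) = h z.1 := by
      rw [inner_sub_right, hh, hθs, hf, linApprox, linApprox, real_inner_comm, real_inner_comm θ]
    rw [semiGrad, gradient_linApprox, real_inner_smul_left, this]
    ring
  -- the reward part
  obtain ⟨C, hC⟩ : ∃ C, ∀ x, ‖h x‖ ≤ C := by
    obtain ⟨C, hC⟩ := (Set.finite_range fun x => ‖h x‖).bddAbove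
    exact ⟨C, fun x => hC ⟨x, rfl⟩⟩
  have hh' := hd h
  have hRint : Integrable (fun z : S × ℝ => z.2 * h z.1) (μ ⊗ₘ Q n) :=
    (hQ.integrable_compProd hp n μ).1.mul_bdd
      (hh'.comp measurable_fst).aestronglyMeasurable
      (Filter.Eventually.of_forall fun z => hC z.1)
  have hRval : ∫ z, z.2 * h z.1 ∂(μ ⊗ₘ Q n) = ∫ x, r x * h x ∂μ := by
    rw [Measure.integral_compProd hRint]
    refine integral_congr_ae (Filter.Eventually.of_forall fun x => ?_)
    simp only [integral_mul_const, hQ.mean n x]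
  have hXval : ∫ z, (γ * f z.2 - f z.1) * h z.1 ∂(μ ⊗ₘ P) =
      ∫ x, (γ * ∫ y, f y ∂(P x) - f x) * h x ∂μ := by
    rw [Measure.integral_compProd (hfin _ _)]
    refine integral_congr_ae (Filter.Eventually.of_forall fun x => ?_)
    simp only
    rw [integral_mul_const, integral_sub (hfin _ _) (hfin _ _), integral_const_mul]
    simp
  have hRint' : Integrable (fun z : S × ℝ × S => z.2.1 * h z.1) ν := by
    rw [← hν] at hRint
    exact hRint.comp_measurable (by fun_prop)
  have hXint' : Integrable (fun z : S × ℝ × S => (γ * f z.2.2 - f z.1) * h z.1) ν := by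
    have := hfin (fun z : S × S => (γ * f z.2 - f z.1) * h z.1) (μ ⊗ₘ P)
    rw [← hν'] at this
    exact this.comp_measurable (by fun_prop)
  have hval : ∫ z, inner ℝ (semiGrad Φ γ z θ) (θs - θ) ∂ν =
      ∫ x, (h x - γ * ∫ y, h y ∂(P x)) * h x ∂μ := by
    simp_rw [hpt]
    rw [integral_add hRint' hXint']
    have e1 := integral_map (μ := ν) (φ := fun z : S × ℝ × S => (z.1, z.2.1))
      (f := fun z : S × ℝ => z.2 * h z.1) (by fun_prop) (by fun_prop)
    have e2 := integral_map (μ := ν) (φ := fun z : S × ℝ × S => (z.1, z.2.2))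
      (f := fun z : S × S => (γ * f z.2 - f z.1) * h z.1) (by fun_prop)
      (hm _).aestronglyMeasurable
    rw [hν, hRval] at e1
    rw [hν', hXval] at e2
    rw [← e1, ← e2, ← integral_add (hfin _ _) (hfin _ _)]
    refine integral_congr_ae (Filter.Eventually.of_forall fun x => ?_)
    -- The Bellman equation eliminates the mean reward, leaving an expression in `h` alone.
    have hb := valueFun_bellman P Q hγ hp hQ x
    simp only [hh]
    rw [integral_sub (hfin _ _) (hfin _ _)]
    rw [← hV] at hb
    rw [show r x = V x - γ * ∫ y, V y ∂(P x) by linarith]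
    ring
  refine ⟨by simp_rw [hpt]; exact hRint'.add hXint', ?_⟩
  -- Stationarity: the successor of a `μ`-distributed state again has law `μ`. Together with `h x *
  -- h y ≤ (h x ^ 2 + h y ^ 2) / 2`, this shows that the discounted cross term costs at most `γ ∫ h²
  -- ∂μ`.
  have hinv : ∫ x, ∫ y, h y ^ 2 ∂(P x) ∂μ = ∫ x, h x ^ 2 ∂μ := by
    have := Measure.integral_compProd (μ := μ) (κ := P) (f := fun z : S × S => h z.2 ^ 2)
      (hfin _ _)
    rw [← this]
    have e := integral_map (μ := μ ⊗ₘ P) (φ := Prod.snd)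
      (f := fun x => h x ^ 2) (by fun_prop) (hm _).aestronglyMeasurable
    have e' : (μ ⊗ₘ P).map Prod.snd = μ := (Measure.snd_compProd μ P).trans hμ.def
    rw [← e, e']
  simp_rw [← hh]
  rw [hval]
  calc (1 - γ) * ∫ x, h x ^ 2 ∂μ
      = ∫ x, h x ^ 2 - γ / 2 * (h x ^ 2 + ∫ y, h y ^ 2 ∂(P x)) ∂μ := by
        rw [integral_sub (hfin _ _) (hfin _ _), integral_const_mul,
          integral_add (hfin _ _) (hfin _ _), hinv]
        ring
    _ ≤ _ := by
        refine integral_mono (hfin _ _) (hfin _ _) fun x => ?_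
        have h1 : (∫ y, h y ∂(P x)) * h x ≤ 1 / 2 * (h x ^ 2 + ∫ y, h y ^ 2 ∂(P x)) := by
          calc (∫ y, h y ∂(P x)) * h x = ∫ y, h y * h x ∂(P x) := (integral_mul_const _ _).symm
            _ ≤ ∫ y, 1 / 2 * (h x ^ 2 + h y ^ 2) ∂(P x) := by
                refine integral_mono (hfin _ _) (hfin _ _) fun y => ?_
                have := sq_nonneg (h x - h y)
                simp only
                nlinarith
            _ = _ := by
                rw [integral_const_mul, integral_add (hfin _ _) (hfin _ _)]
                simp
        have := mul_le_mul_of_nonneg_left h1 hγ.1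
        simp only
        nlinarith

end Gradient

/-! ### Exponential tails for sums along a recursion driven by independent noise. -/

section Recursion

variable {Ω D E F : Type*} [MeasurableSpace Ω] [MeasurableSpace D] [MeasurableSpace E]
  [MeasurableSpace F] {Pr : Measure Ω} [IsProbabilityMeasure Pr]

/-- The two hypotheses make the joint law of the triple a full product; reassociating it gives the
claim. -/
theorem indepFun_prodMk_left {X : Ω → E} {Y : Ω → F} {W : Ω → D} (hX : Measurable X)
    (hY : Measurable Y) (hW : Measurable W) (h : IndepFun X (fun ω => (Y ω, W ω)) Pr)
    (h' : IndepFun Y W Pr) : IndepFun (fun ω => (X ω, Y ω)) W Pr := by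
  rw [indepFun_iff_map_prod_eq_prod_map_map (by fun_prop) (by fun_prop)]
  have h1 := (indepFun_iff_map_prod_eq_prod_map_map (by fun_prop) (by fun_prop)).1 h
  have h2 := (indepFun_iff_map_prod_eq_prod_map_map (by fun_prop) (by fun_prop)).1 h'
  have h3 := (indepFun_iff_map_prod_eq_prod_map_map (by fun_prop) (by fun_prop)).1
    (h.comp measurable_id measurable_fst)
  simp only [Function.id_comp] at h3
  have h4 : Pr.map (fun ω => (X ω, Y ω)) = (Pr.map X).prod (Pr.map Y) := h3
  have : IsProbabilityMeasure (Pr.map X) := Measure.isProbabilityMeasure_map hX.aemeasurable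
  have : IsProbabilityMeasure (Pr.map Y) := Measure.isProbabilityMeasure_map hY.aemeasurable
  have : IsProbabilityMeasure (Pr.map W) := Measure.isProbabilityMeasure_map hW.aemeasurable
  have h5 : Pr.map (fun ω => ((X ω, Y ω), W ω)) =
      (Pr.map (fun ω => (X ω, (Y ω, W ω)))).map MeasurableEquiv.prodAssoc.symm := by
    rw [Measure.map_map (MeasurableEquiv.measurable _) (by fun_prop)]
    rfl
  rw [h5, h1, h2, h4]
  exact ((MeasurableEquiv.map_apply_eq_iff_map_symm_apply_eq _).1 Measure.prodAssoc_prod).symm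

/-- A state driven by independent noise is independent of the next noise variable. -/
theorem indepFun_recursion {Z : ℕ → Ω → D} {Y : ℕ → Ω → E} {step : ℕ → E → D → E}
    (hZm : ∀ n, Measurable (Z n)) (hZ : iIndepFun Z Pr)
    (hY0m : Measurable (Y 0)) (hY0 : IndepFun (Y 0) (fun ω n => Z n ω) Pr)
    (hstep : ∀ n, Measurable (Function.uncurry (step n)))
    (hY : ∀ n ω, Y (n + 1) ω = step n (Y n ω) (Z n ω)) (n : ℕ) : IndepFun (Y n) (Z n) Pr := by
  -- The state at `n` depends only on the initial state and the noise with index strictly below `n`.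
  have hrep : ∀ n, ∃ φ : E × (Finset.range n → D) → E, Measurable φ ∧
      ∀ ω, Y n ω = φ (Y 0 ω, fun i => Z i ω) := by
    intro n
    induction n with
    | zero => exact ⟨Prod.fst, measurable_fst, fun _ => rfl⟩
    | succ n ih =>
      obtain ⟨φ, hφ, hφY⟩ := ih
      refine ⟨fun q => step n
        (φ (q.1, fun i => q.2 ⟨i, Finset.range_subset_range.2 n.le_succ i.2⟩))
        (q.2 ⟨n, Finset.self_mem_range_succ n⟩), ?_, fun ω => by rw [hY, hφY]⟩
      exact (hstep n).comp ((hφ.comp (by fun_prop)).prodMk (by fun_prop))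
  have h1 : IndepFun (fun ω (i : Finset.range n) => Z i ω) (Z n) Pr :=
    (hZ.indepFun_finset (Finset.range n) {n} (by simp) hZm).comp measurable_id
      (measurable_pi_apply (⟨n, by simp⟩ : ({n} : Finset ℕ)))
  have h2 : IndepFun (Y 0) (fun ω => ((fun i : Finset.range n => Z i ω), Z n ω)) Pr :=
    hY0.comp measurable_id
      (by fun_prop : Measurable fun z : ℕ → D => ((fun i : Finset.range n => z i), z n))
  have h3 := indepFun_prodMk_left hY0m (by fun_prop) (hZm n) h2 h1
  obtain ⟨φ, hφ, hφY⟩ := hrep n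
  rw [show Y n = φ ∘ fun ω => (Y 0 ω, fun i : Finset.range n => Z i ω) from funext hφY]
  exact h3.comp hφ measurable_id

theorem measurable_recursion {Z : ℕ → Ω → D} {Y : ℕ → Ω → E} {step : ℕ → E → D → E}
    (hZm : ∀ n, Measurable (Z n)) (hY0m : Measurable (Y 0))
    (hstep : ∀ n, Measurable (Function.uncurry (step n)))
    (hY : ∀ n ω, Y (n + 1) ω = step n (Y n ω) (Z n ω)) (n : ℕ) : Measurable (Y n) := by
  induction n with
  | zero => exact hY0m
  | succ n ih =>
    rw [show Y (n + 1) = fun ω => step n (Y n ω) (Z n ω) from funext (hY n)]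
    exact (hstep n).comp (ih.prodMk (hZm n))

/-- The exponential moment of a sum of increments that are driven by independent noise. -/
theorem lintegral_exp_sum_recursion_le {Z : ℕ → Ω → D} {Y : ℕ → Ω → E} {step : ℕ → E → D → E}
    (hZm : ∀ n, Measurable (Z n)) (hZ : iIndepFun Z Pr)
    (hY0m : Measurable (Y 0)) (hY0 : IndepFun (Y 0) (fun ω n => Z n ω) Pr)
    (hstep : ∀ n, Measurable (Function.uncurry (step n)))
    (hY : ∀ n ω, Y (n + 1) ω = step n (Y n ω) (Z n ω))
    {G : ℕ → E → D → ℝ} (hG : ∀ n, Measurable (Function.uncurry (G n)))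
    {c : ℕ → ℝ} {T : ℕ}
    (hc : ∀ n < T, ∀ ω, ∫⁻ z, ENNReal.ofReal (Real.exp (G n (Y n ω) z)) ∂(Pr.map (Z n)) ≤
      ENNReal.ofReal (Real.exp (c n))) :
    ∫⁻ ω, ENNReal.ofReal (Real.exp (∑ n ∈ Finset.range T, G n (Y n ω) (Z n ω))) ∂Pr ≤
      ENNReal.ofReal (Real.exp (∑ n ∈ Finset.range T, c n)) := by
  have hYm := measurable_recursion hZm hY0m hstep hY
  set A : ℕ → Ω → ℝ := fun m ω => ∑ n ∈ Finset.range m, G n (Y n ω) (Z n ω) with hA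
  have hAm : ∀ m, Measurable (A m) := fun m =>
    Finset.measurable_sum _ fun n _ => (hG n).comp ((hYm n).prodMk (hZm n))
  -- The partial sum is adjoined to the state: the pair obeys a recursion with the same noise, so it
  -- is jointly independent of the next noise variable.
  have hindep : ∀ m, IndepFun (fun ω => (Y m ω, A m ω)) (Z m) Pr := by
    refine indepFun_recursion (Y := fun m ω => (Y m ω, A m ω))
      (step := fun m q z => (step m q.1 z, q.2 + G m q.1 z)) hZm hZ ?_ ?_ ?_ ?_
    · exact hY0m.prodMk (hAm 0)
    · have := hY0.comp (φ := fun y => (y, (0 : ℝ))) (ψ := id) (by fun_prop) measurable_id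
      simpa [hA, Function.comp_def] using this
    · intro m
      have h1 : Measurable fun q : (E × ℝ) × D => (q.1.1, q.2) := by fun_prop
      exact ((hstep m).comp h1).prodMk
        ((measurable_snd.comp measurable_fst).add ((hG m).comp h1))
    · intro m ω
      simp only [hA, Finset.sum_range_succ, hY]
  have key : ∀ m ≤ T, ∫⁻ ω, ENNReal.ofReal (Real.exp (A m ω)) ∂Pr ≤
      ENNReal.ofReal (Real.exp (∑ n ∈ Finset.range m, c n)) := by
    intro m
    induction m with
    | zero => intro _; simp [hA]
    | succ m ih =>
      intro hm
      have hmT : m < T := hm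
      have hlaw := (indepFun_iff_map_prod_eq_prod_map_map
        ((hYm m).prodMk (hAm m)).aemeasurable (hZm m).aemeasurable).1 (hindep m)
      have : IsProbabilityMeasure (Pr.map (Z m)) :=
        Measure.isProbabilityMeasure_map (hZm m).aemeasurable
      set H : (E × ℝ) × D → ENNReal := fun q =>
        ENNReal.ofReal (Real.exp q.1.2) * ENNReal.ofReal (Real.exp (G m q.1.1 q.2)) with hH
      have hHG : Measurable fun q : (E × ℝ) × D =>
          ENNReal.ofReal (Real.exp (G m q.1.1 q.2)) := by
        have h1 : Measurable fun q : (E × ℝ) × D => (q.1.1, q.2) := by fun_prop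
        exact (Real.measurable_exp.comp ((hG m).comp h1)).ennreal_ofReal
      have hHm : Measurable H := Measurable.mul (by fun_prop) hHG
      have hsec : ∀ q : E × ℝ, ∫⁻ z, H (q, z) ∂(Pr.map (Z m)) = ENNReal.ofReal (Real.exp q.2) *
          ∫⁻ z, ENNReal.ofReal (Real.exp (G m q.1 z)) ∂(Pr.map (Z m)) := fun q => by
        have h1 : Measurable fun z => ENNReal.ofReal (Real.exp (G m q.1 z)) :=
          hHG.comp (measurable_prodMk_left (x := q))
        exact lintegral_const_mul (ENNReal.ofReal (Real.exp q.2)) h1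
      calc ∫⁻ ω, ENNReal.ofReal (Real.exp (A (m + 1) ω)) ∂Pr
          = ∫⁻ ω, H ((Y m ω, A m ω), Z m ω) ∂Pr := by
            refine lintegral_congr fun ω => ?_
            simp only [hA, hH, Finset.sum_range_succ, Real.exp_add]
            rw [ENNReal.ofReal_mul (Real.exp_pos _).le]
        -- Tonelli for the product law plays the role of conditioning on the past.
        _ = ∫⁻ ω, ∫⁻ z, H ((Y m ω, A m ω), z) ∂(Pr.map (Z m)) ∂Pr := by
            rw [← lintegral_map (μ := Pr) (f := H) (g := fun ω => ((Y m ω, A m ω), Z m ω)) hHm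
                (((hYm m).prodMk (hAm m)).prodMk (hZm m)), hlaw, lintegral_prod _ hHm.aemeasurable,
              lintegral_map hHm.lintegral_prod_right' ((hYm m).prodMk (hAm m))]
        _ ≤ ∫⁻ ω, ENNReal.ofReal (Real.exp (A m ω)) * ENNReal.ofReal (Real.exp (c m)) ∂Pr := by
            refine lintegral_mono fun ω => ?_
            rw [hsec]
            exact mul_le_mul_right (hc m hmT ω) _
        _ = (∫⁻ ω, ENNReal.ofReal (Real.exp (A m ω)) ∂Pr) * ENNReal.ofReal (Real.exp (c m)) :=
            lintegral_mul_const _ (hAm m).exp.ennreal_ofReal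
        _ ≤ ENNReal.ofReal (Real.exp (∑ n ∈ Finset.range m, c n)) *
              ENNReal.ofReal (Real.exp (c m)) := mul_le_mul_left (ih hmT.le) _
        _ = _ := by
            rw [← ENNReal.ofReal_mul (Real.exp_pos _).le, ← Real.exp_add, Finset.sum_range_succ]
  exact key T le_rfl

/-- The exponential tail bound of a sum of increments that are driven by independent noise. -/
theorem measure_sum_recursion_gt_le {Z : ℕ → Ω → D} {Y : ℕ → Ω → E} {step : ℕ → E → D → E}
    (hZm : ∀ n, Measurable (Z n)) (hZ : iIndepFun Z Pr)
    (hY0m : Measurable (Y 0)) (hY0 : IndepFun (Y 0) (fun ω n => Z n ω) Pr)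
    (hstep : ∀ n, Measurable (Function.uncurry (step n)))
    (hY : ∀ n ω, Y (n + 1) ω = step n (Y n ω) (Z n ω))
    {G : ℕ → E → D → ℝ} (hG : ∀ n, Measurable (Function.uncurry (G n)))
    {c : ℕ → ℝ} {T : ℕ}
    (hc : ∀ n < T, ∀ ω, ∫⁻ z, ENNReal.ofReal (Real.exp (G n (Y n ω) z)) ∂(Pr.map (Z n)) ≤
      ENNReal.ofReal (Real.exp (c n))) (l : ℝ) :
    Pr.real {ω | ∑ n ∈ Finset.range T, c n + l < ∑ n ∈ Finset.range T, G n (Y n ω) (Z n ω)} ≤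
      Real.exp (-l) := by
  have hYm := measurable_recursion hZm hY0m hstep hY
  have h := lintegral_exp_sum_recursion_le hZm hZ hY0m hY0 hstep hY hG hc
  set B := ∑ n ∈ Finset.range T, c n
  set A : Ω → ℝ := fun ω => ∑ n ∈ Finset.range T, G n (Y n ω) (Z n ω) with hA
  have hAm : Measurable A :=
    Finset.measurable_sum _ fun n _ => (hG n).comp ((hYm n).prodMk (hZm n))
  have hM := meas_ge_le_lintegral_div (μ := Pr) (f := fun ω => ENNReal.ofReal (Real.exp (A ω)))
    hAm.exp.ennreal_ofReal.aemeasurable (ε := ENNReal.ofReal (Real.exp (B + l)))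
    (by simp [Real.exp_pos]) ENNReal.ofReal_ne_top
  refine ENNReal.toReal_le_of_le_ofReal (Real.exp_pos _).le ?_
  calc Pr {ω | B + l < A ω}
      ≤ Pr {ω | ENNReal.ofReal (Real.exp (B + l)) ≤ ENNReal.ofReal (Real.exp (A ω))} :=
        measure_mono fun ω hω => ENNReal.ofReal_le_ofReal (Real.exp_le_exp.2 (le_of_lt hω))
    _ ≤ ENNReal.ofReal (Real.exp B) / ENNReal.ofReal (Real.exp (B + l)) :=
        hM.trans (ENNReal.div_le_div_right h _)
    _ = ENNReal.ofReal (Real.exp (-l)) := by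
        rw [← ENNReal.ofReal_div_of_pos (Real.exp_pos _), ← Real.exp_sub]
        congr 2
        ring

end Recursion

/-! ### One-step exponential moments of clipped vectors. -/

section ExponentialMoments

variable {D : Type*} [MeasurableSpace D] {d : ℕ}

/-- Only the dominating function has to be integrable, so the exponentials need no integrability or
measurability argument of their own. -/
theorem lintegral_ofReal_le_of_le_integrable {ν : Measure D} {f k : D → ℝ} (hf : ∀ z, 0 ≤ f z)
    (hfk : ∀ z, f z ≤ k z) (hk : Integrable k ν) {C : ℝ} (hC : ∫ z, k z ∂ν ≤ C) :
    ∫⁻ z, ENNReal.ofReal (f z) ∂ν ≤ ENNReal.ofReal C := by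
  calc _ ≤ ∫⁻ z, ENNReal.ofReal (k z) ∂ν :=
        lintegral_mono fun z => ENNReal.ofReal_le_ofReal (hfk z)
    _ = ENNReal.ofReal (∫ z, k z ∂ν) := (ofReal_integral_eq_lintegral_ofReal hk
        (Filter.Eventually.of_forall fun z => (hf z).trans (hfk z))).symm
    _ ≤ _ := ENNReal.ofReal_le_ofReal hC

theorem sq_norm_le_rpow_mul {p b : ℝ} (hp : p ∈ Set.Ioc (0 : ℝ) 1)
    {g : EuclideanSpace ℝ (Fin d)} (h : ‖g‖ ≤ b) :
    ‖g‖ ^ 2 ≤ ‖g‖ ^ (1 + p) * b ^ (1 - p) := by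
  rw [← Real.rpow_two, show (2 : ℝ) = (1 + p) + (1 - p) by ring,
    Real.rpow_add_of_nonneg (norm_nonneg _) (by linarith [hp.1]) (by linarith [hp.2])]
  exact mul_le_mul_of_nonneg_left
    (Real.rpow_le_rpow (norm_nonneg _) h (by linarith [hp.2])) (by positivity)

theorem sq_norm_clip_le {p b : ℝ} (hp : p ∈ Set.Ioc (0 : ℝ) 1) (hb : 0 < b)
    (g : EuclideanSpace ℝ (Fin d)) :
    ‖clip b g‖ ^ 2 ≤ ‖g‖ ^ (1 + p) * b ^ (1 - p) := by
  unfold clip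
  split_ifs with h
  · exact sq_norm_le_rpow_mul hp h
  · rw [norm_zero, zero_pow two_ne_zero]; positivity

theorem norm_clip_le {b : ℝ} (hb : 0 ≤ b) (g : EuclideanSpace ℝ (Fin d)) : ‖clip b g‖ ≤ b := by
  unfold clip
  split_ifs with h
  · exact h
  · rwa [norm_zero]

/-- The clipping bias and the clipped second moment share one moment of order `1 + p`. -/
theorem norm_sub_clip_add_sq_le {p b B : ℝ} (hp : p ∈ Set.Ioc (0 : ℝ) 1) (hb : 0 < b)
    (hbB : b ≤ B) (g : EuclideanSpace ℝ (Fin d)) :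
    ‖g - clip b g‖ + ‖clip b g‖ ^ 2 / B ≤ ‖g‖ ^ (1 + p) * b ^ (-p) := by
  unfold clip
  split_ifs with h
  · rw [sub_self, norm_zero, zero_add, div_le_iff₀ (hb.trans_le hbB)]
    have h1 : b ^ (1 - p) = b ^ (-p) * b := by
      rw [show 1 - p = -p + 1 by ring, Real.rpow_add hb, Real.rpow_one]
    calc ‖g‖ ^ 2 ≤ ‖g‖ ^ (1 + p) * b ^ (1 - p) := sq_norm_le_rpow_mul hp h
      _ = ‖g‖ ^ (1 + p) * b ^ (-p) * b := by rw [h1, mul_assoc]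
      _ ≤ _ := mul_le_mul_of_nonneg_left hbB (by positivity)
  · have hg : b < ‖g‖ := not_le.1 h
    have hg0 : 0 < ‖g‖ := hb.trans hg
    rw [sub_zero, norm_zero, zero_pow two_ne_zero, zero_div, add_zero, Real.rpow_neg hb.le,
      ← div_eq_mul_inv, le_div_iff₀ (by positivity), Real.rpow_add hg0, Real.rpow_one]
    exact mul_le_mul_of_nonneg_left (Real.rpow_le_rpow hb.le hg.le hp.1.le) hg0.le

variable {ν : Measure D} [IsProbabilityMeasure ν]

/-- With `l = 1/(2ρB)` and `c` the clipped vector, `|l ⟨c, w⟩| ≤ ‖c‖/B ≤ 1`, hence `exp (-y) ≤ 1 - y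
+ y²` applies to `y = l ⟨c, w⟩`. Replacing `c` by `g` in the linear term costs `‖g - c‖/B`, and the
quadratic term is at most `‖c‖²/B²`; `norm_sub_clip_add_sq_le` bounds their sum. -/
theorem lintegral_exp_inner_clip_le {p b B ρ M m : ℝ} (hp : p ∈ Set.Ioc (0 : ℝ) 1) (hb : 0 < b)
    (hbB : b ≤ B) (hρ : 0 < ρ) {g : D → EuclideanSpace ℝ (Fin d)}
    {w : EuclideanSpace ℝ (Fin d)} (hw : ‖w‖ ≤ 2 * ρ)
    (hgw : Integrable (fun z => inner ℝ (g z) w) ν) (hm : m ≤ ∫ z, inner ℝ (g z) w ∂ν)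
    (hg : Integrable (fun z => ‖g z‖ ^ (1 + p)) ν) (hM : ∫ z, ‖g z‖ ^ (1 + p) ∂ν ≤ M) :
    ∫⁻ z, ENNReal.ofReal (Real.exp (1 / (2 * ρ * B) * (m - inner ℝ (clip b (g z)) w))) ∂ν ≤
      ENNReal.ofReal (Real.exp (M * b ^ (-p) / B)) := by
  have hB : 0 < B := hb.trans_le hbB
  set l := 1 / (2 * ρ * B) with hl
  have hl0 : 0 < l := by positivity
  have hlw : ∀ v : EuclideanSpace ℝ (Fin d), |l * inner ℝ v w| ≤ ‖v‖ / B := by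
    intro v
    rw [abs_mul, abs_of_pos hl0]
    calc l * |inner ℝ v w| ≤ l * (‖v‖ * (2 * ρ)) := mul_le_mul_of_nonneg_left
          ((abs_real_inner_le_norm v w).trans
            (mul_le_mul_of_nonneg_left hw (norm_nonneg _))) hl0.le
      _ = ‖v‖ / B := by rw [hl]; field_simp
  have hsub : Integrable (fun z => 1 - l * inner ℝ (g z) w) ν :=
    (integrable_const 1).sub (hgw.const_mul l)
  refine lintegral_ofReal_le_of_le_integrable
    (k := fun z => Real.exp (l * m) *
      (1 - l * inner ℝ (g z) w + ‖g z‖ ^ (1 + p) * (b ^ (-p) / B)))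
    (fun z => (Real.exp_pos _).le) (fun z => ?_)
    ((hsub.add (hg.mul_const _)).const_mul _) ?_
  · rw [mul_sub, sub_eq_add_neg, Real.exp_add]
    refine mul_le_mul_of_nonneg_left ?_ (Real.exp_pos _).le
    set c := clip b (g z) with hc
    have hcb : ‖c‖ / B ≤ 1 := (div_le_one hB).2 ((norm_clip_le hb.le _).trans hbB)
    have h1 := hlw c
    have h2 := (le_abs_self _).trans (Real.abs_exp_sub_one_sub_id_le
      (x := -(l * inner ℝ c w)) (by rw [abs_neg]; exact h1.trans hcb))
    have h3 : (-(l * inner ℝ c w)) ^ 2 ≤ ‖c‖ ^ 2 / B / B := by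
      rw [neg_sq, ← sq_abs, div_div, ← sq B, ← div_pow]
      exact pow_le_pow_left₀ (abs_nonneg _) h1 2
    have h4 := (le_abs_self _).trans (hlw (g z - c))
    rw [inner_sub_left, mul_sub] at h4
    have h5 := div_le_div_of_nonneg_right (norm_sub_clip_add_sq_le hp hb hbB (g z)) hB.le
    rw [← hc, add_div, mul_div_assoc] at h5
    linarith
  · rw [integral_const_mul, integral_add hsub (hg.mul_const _), integral_sub (integrable_const 1) (hgw.const_mul l), integral_const_mul,
      integral_mul_const]
    have h1 : (∫ z, ‖g z‖ ^ (1 + p) ∂ν) * (b ^ (-p) / B) ≤ M * b ^ (-p) / B := by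
      rw [mul_div_assoc]
      exact mul_le_mul_of_nonneg_right hM (by positivity)
    have h2 := mul_le_mul_of_nonneg_left hm hl0.le
    -- After `1 + x ≤ exp x` the drift `l * m` cancels, leaving only the moment term.
    calc _ ≤ Real.exp (l * m) * Real.exp (-(l * m) + M * b ^ (-p) / B) := by
          refine mul_le_mul_of_nonneg_left ?_ (Real.exp_pos _).le
          have := Real.add_one_le_exp (-(l * m) + M * b ^ (-p) / B)
          simp only [integral_const, probReal_univ, smul_eq_mul, mul_one]
          linarith
      _ = _ := by rw [← Real.exp_add]; congr 1; ring

theorem exp_le_one_add_mul {x : ℝ} (h0 : 0 ≤ x) (h1 : x ≤ 1) :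
    Real.exp x ≤ 1 + (Real.exp 1 - 1) * x := by
  have h := convexOn_exp.2 (Set.mem_univ 0) (Set.mem_univ 1) (sub_nonneg.2 h1) h0 (by ring)
  simp only [smul_eq_mul, mul_zero, mul_one, zero_add, Real.exp_zero] at h
  linarith

/-- Since `b ≤ B` the exponent lies in `[0, 1]`, where the exponential is below its chord. The chord
is linear in the clipped square, so a moment of order `1 + p` suffices. -/
theorem lintegral_exp_sq_norm_clip_le {p b B M : ℝ} (hp : p ∈ Set.Ioc (0 : ℝ) 1) (hb : 0 < b)
    (hbB : b ≤ B) {g : D → EuclideanSpace ℝ (Fin d)}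
    (hg : Integrable (fun z => ‖g z‖ ^ (1 + p)) ν) (hM : ∫ z, ‖g z‖ ^ (1 + p) ∂ν ≤ M) :
    ∫⁻ z, ENNReal.ofReal (Real.exp (‖clip b (g z)‖ ^ 2 / B ^ 2)) ∂ν ≤
      ENNReal.ofReal (Real.exp ((Real.exp 1 - 1) * (M * b ^ (1 - p) / B ^ 2))) := by
  have hB : 0 < B := hb.trans_le hbB
  have he : 0 ≤ Real.exp 1 - 1 := by linarith [Real.add_one_le_exp 1]
  refine lintegral_ofReal_le_of_le_integrable
    (k := fun z => 1 + ‖g z‖ ^ (1 + p) * ((Real.exp 1 - 1) * (b ^ (1 - p) / B ^ 2)))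
    (fun z => (Real.exp_pos _).le) (fun z => ?_)
    ((integrable_const 1).add (hg.mul_const _)) ?_
  · have h1 : ‖clip b (g z)‖ ^ 2 / B ^ 2 ≤ 1 := by
      rw [← div_pow]
      exact pow_le_one₀ (by positivity) ((div_le_one hB).2 ((norm_clip_le hb.le _).trans hbB))
    refine (exp_le_one_add_mul (by positivity) h1).trans ?_
    have h2 := div_le_div_of_nonneg_right (sq_norm_clip_le hp hb (g z)) (sq_nonneg B)
    have h3 := mul_le_mul_of_nonneg_left h2 he
    rw [mul_div_assoc] at h3
    linarith
  · rw [integral_add (integrable_const 1) (hg.mul_const _), integral_mul_const]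
    simp only [integral_const, probReal_univ, smul_eq_mul, mul_one]
    have h1 := mul_le_mul_of_nonneg_right hM
      (by positivity : 0 ≤ (Real.exp 1 - 1) * (b ^ (1 - p) / B ^ 2))
    have h2 := Real.add_one_le_exp ((Real.exp 1 - 1) * (M * b ^ (1 - p) / B ^ 2))
    have h3 : (Real.exp 1 - 1) * (M * b ^ (1 - p) / B ^ 2) =
      M * ((Real.exp 1 - 1) * (b ^ (1 - p) / B ^ 2)) := by ring
    linarith

end ExponentialMoments

/-! ### Pathwise bounds: projection, regret and averaging. -/

section Deterministic

variable {S : Type*} {d : ℕ}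

/-- The inner product of `z - Πz` with `Πz - y` is nonnegative for `y` in the ball, so expanding `‖z
- y‖²` around `Πz` only adds nonnegative terms. -/
theorem norm_projBall_sub_le {ρ : ℝ} (hρ : 0 ≤ ρ) (z : EuclideanSpace ℝ (Fin d))
    {y : EuclideanSpace ℝ (Fin d)} (hy : ‖y‖ ≤ ρ) : ‖projBall ρ z - y‖ ≤ ‖z - y‖ := by
  unfold projBall
  split_ifs with h
  · exact le_rfl
  · have hz : ρ < ‖z‖ := not_le.1 h
    have hz0 : 0 < ‖z‖ := hρ.trans_lt hz
    set c := ρ / ‖z‖ with hc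
    have hc1 : c ≤ 1 := (div_le_one hz0).2 hz.le
    have hcz : c * ‖z‖ = ρ := div_mul_cancel₀ _ hz0.ne'
    have h1 : inner ℝ (z - c • z) (c • z - y) = (1 - c) * (ρ * ‖z‖ - inner ℝ z y) := by
      rw [show z - c • z = (1 - c) • z by rw [sub_smul, one_smul], real_inner_smul_left,
        inner_sub_right, real_inner_smul_right, real_inner_self_eq_norm_sq, ← hcz]
      ring
    have h2 : inner ℝ z y ≤ ρ * ‖z‖ := (real_inner_le_norm z y).trans (by nlinarith)
    have h3 := norm_add_sq_real (z - c • z) (c • z - y)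
    rw [sub_add_sub_cancel, h1] at h3
    refine abs_le_of_sq_le_sq' ?_ (norm_nonneg _) |>.2
    nlinarith [sq_nonneg ‖z - c • z‖, mul_nonneg (sub_nonneg.2 hc1) (sub_nonneg.2 h2)]

theorem norm_robustTD_le (Φ : S → EuclideanSpace ℝ (Fin d)) (γ : ℝ) {ρ : ℝ} (hρ : 0 ≤ ρ) (η : ℝ)
    (b : ℕ → ℝ) {θ₁ : EuclideanSpace ℝ (Fin d)} (hθ₁ : ‖θ₁‖ ≤ ρ) (z : ℕ → S × ℝ × S) (n : ℕ) :
    ‖robustTD Φ γ ρ η b θ₁ z n‖ ≤ ρ := by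
  cases n with
  | zero => exact hθ₁
  | succ n => exact (projBall_isMinOn hρ _).1

/-- The regret bound of projected gradient steps. -/
theorem sum_inner_clip_le (Φ : S → EuclideanSpace ℝ (Fin d)) (γ : ℝ) {ρ η : ℝ} (hρ : 0 < ρ)
    (hη : 0 < η) (b : ℕ → ℝ) {θ₁ θs : EuclideanSpace ℝ (Fin d)} (hθ₁ : ‖θ₁‖ ≤ ρ) (hθs : ‖θs‖ ≤ ρ)
    (z : ℕ → S × ℝ × S) (T : ℕ) :
    ∑ n ∈ Finset.range T, inner ℝ
        (clip (b (n + 1)) (semiGrad Φ γ (z n) (robustTD Φ γ ρ η b θ₁ z n)))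
        (θs - robustTD Φ γ ρ η b θ₁ z n) ≤
      2 * ρ ^ 2 / η + η / 2 * ∑ n ∈ Finset.range T,
        ‖clip (b (n + 1)) (semiGrad Φ γ (z n) (robustTD Φ γ ρ η b θ₁ z n))‖ ^ 2 := by
  set θ := robustTD Φ γ ρ η b θ₁ z with hθ
  set c : ℕ → EuclideanSpace ℝ (Fin d) := fun n => clip (b (n + 1)) (semiGrad Φ γ (z n) (θ n))
    with hc
  have hstep : ∀ n, ‖θ (n + 1) - θs‖ ^ 2 ≤
      ‖θ n - θs‖ ^ 2 - 2 * η * inner ℝ (c n) (θs - θ n) + η ^ 2 * ‖c n‖ ^ 2 := by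
    intro n
    have h1 : ‖θ (n + 1) - θs‖ ≤ ‖θ n + η • c n - θs‖ := norm_projBall_sub_le hρ.le _ hθs
    refine (pow_le_pow_left₀ (norm_nonneg _) h1 2).trans_eq ?_
    rw [add_sub_right_comm, norm_add_sq_real, real_inner_smul_right, norm_smul, mul_pow,
      Real.norm_eq_abs, sq_abs, real_inner_comm, ← neg_sub θs (θ n), inner_neg_right, norm_neg]
    ring
  have hsum : ∀ T : ℕ, ‖θ T - θs‖ ^ 2 + 2 * η * ∑ n ∈ Finset.range T, inner ℝ (c n) (θs - θ n) ≤
      ‖θ 0 - θs‖ ^ 2 + η ^ 2 * ∑ n ∈ Finset.range T, ‖c n‖ ^ 2 := by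
    intro T
    induction T with
    | zero => simp
    | succ T ih =>
      rw [Finset.sum_range_succ, Finset.sum_range_succ]
      linarith [hstep T]
  -- The squared diameter `4ρ²`, divided by `2η`, is the source of `2ρ²/η`.
  have h0 : ‖θ 0 - θs‖ ^ 2 ≤ (2 * ρ) ^ 2 := by
    refine pow_le_pow_left₀ (norm_nonneg _) ((norm_sub_le _ _).trans ?_) 2
    have : ‖θ 0‖ ≤ ρ := hθ₁
    linarith
  have h1 := hsum T
  have h2 := sq_nonneg ‖θ T - θs‖
  set I := ∑ n ∈ Finset.range T, inner ℝ (c n) (θs - θ n)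
  set A := ∑ n ∈ Finset.range T, ‖c n‖ ^ 2
  have h3 : 2 * η * I ≤ 4 * ρ ^ 2 + η ^ 2 * A := by linarith
  have h4 : I = (2 * η * I) / (2 * η) := by field_simp
  rw [h4]
  calc _ ≤ (4 * ρ ^ 2 + η ^ 2 * A) / (2 * η) := div_le_div_of_nonneg_right h3 (by positivity)
    _ = _ := by field_simp; ring

/-- The prediction is linear in the parameter, so the error of the average is the average of the
errors; Cauchy–Schwarz does the rest. -/
theorem sq_sub_linApprox_average_le (Φ : S → EuclideanSpace ℝ (Fin d))
    (θ : ℕ → EuclideanSpace ℝ (Fin d)) (v : ℝ) (x : S) {T : ℕ} (hT : 1 ≤ T) :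
    (v - linApprox Φ ((1 / (T : ℝ)) • ∑ n ∈ Finset.range T, θ n) x) ^ 2 ≤
      1 / (T : ℝ) * ∑ n ∈ Finset.range T, (v - linApprox Φ (θ n) x) ^ 2 := by
  have hT0 : (0 : ℝ) < T := by exact_mod_cast hT
  have h1 : v - linApprox Φ ((1 / (T : ℝ)) • ∑ n ∈ Finset.range T, θ n) x =
      (∑ n ∈ Finset.range T, (v - linApprox Φ (θ n) x)) / T := by
    rw [Finset.sum_sub_distrib, Finset.sum_const, Finset.card_range, nsmul_eq_mul]
    simp only [linApprox, real_inner_smul_left, sum_inner]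
    field_simp
  have h2 := sq_sum_le_card_mul_sum_sq (s := Finset.range T)
    (f := fun n => v - linApprox Φ (θ n) x)
  rw [Finset.card_range] at h2
  rw [h1, div_pow, div_le_iff₀ (by positivity)]
  refine h2.trans_eq ?_
  field_simp

end Deterministic

/-! ### Clipping radii, step size and numerical constants. -/

section Parameters

variable {p u L ρ : ℝ} {T : ℕ}

theorem clipRadius_pos (hu : 0 < u) (hL : 0 < L) {t : ℕ} (ht : 1 ≤ t) : 0 < clipRadius p u L t := by
  have : (0 : ℝ) < t := by exact_mod_cast ht
  unfold clipRadius
  positivity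

theorem clipRadius_mono (hp : 0 < p) (hu : 0 < u) (hL : 0 < L) {s t : ℕ} (h : s ≤ t) :
    clipRadius p u L s ≤ clipRadius p u L t := by
  have : (s : ℝ) ≤ t := by exact_mod_cast h
  unfold clipRadius
  gcongr

theorem stepSize_pos (hu : 0 < u) (hL : 0 < L) (hρ : 0 < ρ) (hT : 1 ≤ T) :
    0 < stepSize p u L ρ T := by
  have : (0 : ℝ) < T := by exact_mod_cast hT
  unfold stepSize
  positivity

theorem clipRadius_rpow (hp : 0 < p) (hu : 0 < u) (hL : 0 < L) (t : ℕ) :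
    clipRadius p u L t ^ (1 + p) = u * t / L := by
  rw [clipRadius, ← Real.rpow_mul (by positivity), one_div_mul_cancel (by positivity),
    Real.rpow_one]

theorem clipRadius_eq (hu : 0 < u) (hL : 0 < L) (hT : 1 ≤ T) :
    clipRadius p u L T = (u * T) ^ (1 / (1 + p)) * L ^ (-(1 / (1 + p))) := by
  rw [clipRadius, Real.div_rpow (by positivity) hL.le, Real.rpow_neg hL.le, div_eq_mul_inv]

theorem clipRadius_mul_logTerm (hp : 0 < p) (hu : 0 < u) (hL : 0 < L) (hT : 1 ≤ T) :
    clipRadius p u L T * L = (u * T) ^ (1 / (1 + p)) * L ^ (p / (1 + p)) := by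
  rw [clipRadius_eq hu hL hT, mul_assoc, ← Real.rpow_add_one hL.ne']
  congr 2
  field_simp
  ring

/-- The step size equals `√2 ρ / (B √L)` with `B` the last radius. It balances `2ρ²/η` against `η B²
L`, which is why `stepSize_mul_clipRadius_sq` has the same right-hand side. -/
theorem two_mul_sq_div_stepSize (hu : 0 < u) (hL : 0 < L) (hρ : 0 < ρ) (hT : 1 ≤ T) :
    2 * ρ ^ 2 / stepSize p u L ρ T =
      √2 * (ρ * ((u * T) ^ (1 / (1 + p)) * L ^ (-((1 - p) / (2 * (1 + p)))))) := by
  have hT0 : (0 : ℝ) < T := by exact_mod_cast hT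
  rw [stepSize, Real.rpow_neg hL.le]
  have h2 : √2 * √2 = 2 := Real.mul_self_sqrt zero_le_two
  have h3 : 0 < √2 := by positivity
  have h4 : 0 < L ^ ((1 - p) / (2 * (1 + p))) := by positivity
  have h5 : 0 < (u * T) ^ (1 / (1 + p)) := by positivity
  field_simp
  linarith

theorem stepSize_mul_clipRadius_sq (hp : 0 < p) (hu : 0 < u) (hL : 0 < L) (hT : 1 ≤ T) :
    stepSize p u L ρ T * (clipRadius p u L T ^ 2 * L) =
      √2 * (ρ * ((u * T) ^ (1 / (1 + p)) * L ^ (-((1 - p) / (2 * (1 + p)))))) := by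
  have hT0 : (0 : ℝ) < T := by exact_mod_cast hT
  have h5 : 0 < (u * T) ^ (1 / (1 + p)) := by positivity
  have h6 : L ^ (-((1 - p) / (2 * (1 + p)))) =
      L ^ ((1 - p) / (2 * (1 + p))) * (L ^ (-(1 / (1 + p)))) ^ 2 * L := by
    rw [← Real.rpow_natCast, ← Real.rpow_mul hL.le, ← Real.rpow_add hL, ← Real.rpow_add_one hL.ne']
    congr 1
    push_cast
    field_simp
    ring
  rw [stepSize, clipRadius_eq hu hL hT, h6]
  field_simp

theorem sum_rpow_neg_half_le (T : ℕ) :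
    ∑ n ∈ Finset.range T, ((n + 1 : ℕ) : ℝ) ^ (-(1 / 2) : ℝ) ≤ 2 * (T : ℝ) ^ (1 / 2 : ℝ) := by
  induction T with
  | zero => simp
  | succ T ih =>
    rw [Finset.sum_range_succ]
    refine (add_le_add_left ih _).trans ?_
    rw [Real.rpow_neg (by positivity), ← Real.sqrt_eq_rpow, ← Real.sqrt_eq_rpow]
    have h0 : 0 < √((T + 1 : ℕ) : ℝ) := by positivity
    have h1 : √((T + 1 : ℕ) : ℝ) ^ 2 = T + 1 := by rw [Real.sq_sqrt (by positivity)]; push_cast; rfl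
    have h2 : √(T : ℝ) ^ 2 = T := Real.sq_sqrt (by positivity)
    set a := √((T + 1 : ℕ) : ℝ)
    set b := √(T : ℝ)
    have h3 : a * a⁻¹ = 1 := mul_inv_cancel₀ h0.ne'
    refine le_of_mul_le_mul_left ?_ h0
    -- As `a² - b² = 1`, the goal multiplied by `a` reduces to `(a - b)² ≥ 0`.
    nlinarith [sq_nonneg (a - b)]

/-- The excess power `(n + 1) ^ (1/2 - a)` is at most `T ^ (1/2 - a)`, which reduces to exponent
`1/2` and keeps the constant `2` uniform in `a`. It is used with `a = p / (1 + p)`, at most `1/2`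
because `p ≤ 1`. -/
theorem sum_rpow_neg_le {a : ℝ} (ha : a ≤ 1 / 2) (T : ℕ) :
    ∑ n ∈ Finset.range T, ((n + 1 : ℕ) : ℝ) ^ (-a) ≤ 2 * (T : ℝ) ^ (1 - a) := by
  rcases Nat.eq_zero_or_pos T with rfl | hT
  · simpa using Real.rpow_nonneg le_rfl _
  have hT0 : (0 : ℝ) < T := by exact_mod_cast hT
  calc _ ≤ ∑ n ∈ Finset.range T, (T : ℝ) ^ (1 / 2 - a) * ((n + 1 : ℕ) : ℝ) ^ (-(1 / 2) : ℝ) := by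
        refine Finset.sum_le_sum fun n hn => ?_
        have hn0 : (0 : ℝ) < (n + 1 : ℕ) := by positivity
        have hnT : ((n + 1 : ℕ) : ℝ) ≤ T := by exact_mod_cast Finset.mem_range.1 hn
        rw [show -a = (1 / 2 - a) + -(1 / 2) by ring, Real.rpow_add hn0]
        exact mul_le_mul_of_nonneg_right (Real.rpow_le_rpow hn0.le hnT (by linarith))
          (by positivity)
    _ ≤ (T : ℝ) ^ (1 / 2 - a) * (2 * (T : ℝ) ^ (1 / 2 : ℝ)) := by
        rw [← Finset.mul_sum]
        exact mul_le_mul_of_nonneg_left (sum_rpow_neg_half_le T) (by positivity)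
    _ = 2 * (T : ℝ) ^ (1 - a) := by
        rw [show 1 - a = (1 / 2 - a) + 1 / 2 by ring, Real.rpow_add hT0]
        ring

theorem sum_mul_clipRadius_rpow_neg_le (hp : p ∈ Set.Ioc (0 : ℝ) 1) (hu : 0 < u) (hL : 0 < L)
    (T : ℕ) : ∑ n ∈ Finset.range T, u * clipRadius p u L (n + 1) ^ (-p) ≤
      2 * ((u * T) ^ (1 / (1 + p)) * L ^ (p / (1 + p))) := by
  obtain ⟨hp0, hp1⟩ := hp
  have hq : 1 - p / (1 + p) = 1 / (1 + p) := by field_simp; ring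
  have hterm : ∀ n : ℕ, u * clipRadius p u L (n + 1) ^ (-p) =
      u ^ (1 / (1 + p)) * L ^ (p / (1 + p)) * ((n + 1 : ℕ) : ℝ) ^ (-(p / (1 + p))) := by
    intro n
    rw [clipRadius, ← Real.rpow_mul (by positivity), show 1 / (1 + p) * -p = -(p / (1 + p)) by ring,
      Real.div_rpow (by positivity) hL.le, Real.mul_rpow hu.le (by positivity),
      Real.rpow_neg hL.le, div_inv_eq_mul, ← hq, sub_eq_add_neg, Real.rpow_add hu, Real.rpow_one]
    ring
  rw [Finset.sum_congr rfl fun n _ => hterm n, ← Finset.mul_sum,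
    Real.mul_rpow hu.le (by positivity)]
  have h := sum_rpow_neg_le (a := p / (1 + p))
    (by rw [div_le_div_iff₀ (by positivity) two_pos]; linarith) T
  rw [hq] at h
  calc _ ≤ u ^ (1 / (1 + p)) * L ^ (p / (1 + p)) * (2 * (T : ℝ) ^ (1 / (1 + p))) :=
        mul_le_mul_of_nonneg_left h (by positivity)
    _ = _ := by ring

/-- Monotonicity replaces each radius by the last one `B`; then every term is `u / B ^ (1 + p) = L /
T`. -/
theorem sum_mul_clipRadius_rpow_div_sq_le (hp : p ∈ Set.Ioc (0 : ℝ) 1) (hu : 0 < u) (hL : 0 < L)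
    (hT : 1 ≤ T) : ∑ n ∈ Finset.range T,
      u * clipRadius p u L (n + 1) ^ (1 - p) / clipRadius p u L T ^ 2 ≤ L := by
  have hT0 : (0 : ℝ) < T := by exact_mod_cast hT
  have hB := clipRadius_pos (p := p) hu hL hT
  set B := clipRadius p u L T with hBdef
  have hBq : B ^ 2 = B ^ (1 - p) * (u * T / L) := by
    rw [← clipRadius_rpow hp.1 hu hL T, ← hBdef, ← Real.rpow_add hB, ← Real.rpow_two]
    congr 1
    ring
  have hb : 0 < B ^ (1 - p) := by positivity
  calc _ ≤ ∑ n ∈ Finset.range T, u * B ^ (1 - p) / B ^ 2 := by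
        refine Finset.sum_le_sum fun n hn => ?_
        have h1 := clipRadius_pos (p := p) hu hL (Nat.le_add_left 1 n)
        have h2 := clipRadius_mono hp.1 hu hL (Nat.succ_le_of_lt (Finset.mem_range.1 hn))
        have h3 : clipRadius p u L (n + 1) ^ (1 - p) ≤ B ^ (1 - p) :=
          Real.rpow_le_rpow h1.le h2 (by linarith [hp.2])
        gcongr
    _ = L := by
        rw [Finset.sum_const, Finset.card_range, nsmul_eq_mul, hBq]
        field_simp

theorem sqrt_two_add_le_three_and_half :
    √2 + ((Real.exp 1 - 1) * (9 / 8) + 1) / 2 * √2 ≤ 7 / 2 := by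
  have h1 := Real.exp_one_lt_d9
  have h2 : √2 ≤ 1.414214 := Real.sqrt_le_iff.2 ⟨by norm_num, by norm_num⟩
  have h3 : 0 ≤ √2 := Real.sqrt_nonneg 2
  have h4 : 0 ≤ 1 + ((Real.exp 1 - 1) * (9 / 8) + 1) / 2 := by linarith [Real.exp_pos 1]
  calc √2 + ((Real.exp 1 - 1) * (9 / 8) + 1) / 2 * √2
      = √2 * (1 + ((Real.exp 1 - 1) * (9 / 8) + 1) / 2) := by ring
    _ ≤ 1.414214 * (1 + ((2.7182818286 - 1) * (9 / 8) + 1) / 2) := by gcongr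
    _ ≤ 7 / 2 := by norm_num

end Parameters

end RobustTD

/-! ### Assembly of the high-probability bound. -/

theorem theorem3 {S : Type*} [Fintype S] [MeasurableSpace S] [MeasurableSingletonClass S]
    {Ω : Type*} [MeasurableSpace Ω] (Pr : Measure Ω) [IsProbabilityMeasure Pr]
    -- the Markov reward process
    (P : Kernel S S) [IsMarkovKernel P] (μ : Measure S) [IsProbabilityMeasure μ]
    (Q : ℕ → Kernel S ℝ) [∀ n, IsMarkovKernel (Q n)] (r : S → ℝ)
    (γ p u₀ : ℝ) (hγ : γ ∈ Set.Ico (0 : ℝ) 1) (hp : p ∈ Set.Ioc (0 : ℝ) 1) (hu₀ : 0 < u₀)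
    (hP : RobustTD.IsErgodic P μ) (hQ : RobustTD.IsHeavyTailedReward Q p u₀ r)
    -- linear function approximation and realizability
    (d : ℕ) (Φ : S → EuclideanSpace ℝ (Fin d)) (hΦ : ∀ x, ‖Φ x‖ ≤ 1)
    (ρ : ℝ) (hρ : 0 < ρ)
    (hreal : ∃ θs : EuclideanSpace ℝ (Fin d), ‖θs‖ ≤ ρ ∧
      ∀ x, RobustTD.valueFun P Q γ x = RobustTD.linApprox Φ θs x)
    -- initialization and iid data
    (θ₁ : Ω → EuclideanSpace ℝ (Fin d)) (hθ₁ : ∀ ω, ‖θ₁ ω‖ ≤ ρ)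
    (Z : ℕ → Ω → S × ℝ × S) (hZ : RobustTD.IsIIDSampling Pr P Q μ θ₁ Z)
    (T : ℕ) (hT : 1 ≤ T) (δ : ℝ) (hδ : δ ∈ Set.Ioo (0 : ℝ) 1)
    (u L : ℝ) (hu : u = RobustTD.gradMoment p u₀ ρ) (hL : L = RobustTD.logTerm δ) :
    1 - δ ≤ Pr.real {ω |
      ∑ x, μ.real {x} * (RobustTD.valueFun P Q γ x - RobustTD.linApprox Φ
          (RobustTD.avgIterate Φ γ ρ (RobustTD.stepSize p u L ρ T) (RobustTD.clipRadius p u L) (θ₁ ω)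
            (fun n => Z n ω) T) x) ^ 2
        ≤ ρ * u ^ (1 / (1 + p)) / ((1 - γ) * (T : ℝ) ^ (p / (1 + p))) *
          (3 * L ^ (-((1 - p) / (2 * (1 + p)))) + 7 * L ^ (p / (1 + p)))} := by
  obtain ⟨θs, hθsρ, hθs⟩ := hreal
  have hu0 : 0 < u := hu ▸ RobustTD.gradMoment_pos hu₀ hρ
  have hγ1 : 0 < 1 - γ := sub_pos.2 hγ.2
  have hT0 : (0 : ℝ) < T := by exact_mod_cast hT
  have hp0 := hp.1
  -- the logarithmic factor
  have hlog2 : Real.log (2 / δ) ≤ L := by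
    rw [hL, RobustTD.logTerm]
    exact Real.log_le_log (div_pos two_pos hδ.1)
      (div_le_div_of_nonneg_right (by norm_num) hδ.1.le)
  have hL1 : 1 ≤ L := by
    rw [hL, RobustTD.logTerm, Real.le_log_iff_exp_le (div_pos (by norm_num) hδ.1),
      le_div_iff₀ hδ.1]
    nlinarith [Real.exp_one_lt_three, Real.exp_pos 1, hδ.1, hδ.2]
  have hL0 : 0 < L := zero_lt_one.trans_le hL1
  have htail : Real.exp (-Real.log (2 / δ)) = δ / 2 := by
    rw [← Real.log_inv, inv_div, Real.exp_log (div_pos hδ.1 two_pos)]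
  -- abbreviations
  set η := RobustTD.stepSize p u L ρ T with hη
  have hη0 : 0 < η := RobustTD.stepSize_pos hu0 hL0 hρ hT
  set b := RobustTD.clipRadius p u L with hb
  have hb0 : ∀ n, 0 < b (n + 1) := fun n => RobustTD.clipRadius_pos hu0 hL0 (Nat.le_add_left 1 n)
  set B := b T with hB
  have hB0 : 0 < B := RobustTD.clipRadius_pos hu0 hL0 hT
  have hbB : ∀ n < T, b (n + 1) ≤ B := fun n hn => RobustTD.clipRadius_mono hp0 hu0 hL0 hn
  set W := (u * T) ^ (1 / (1 + p)) with hW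
  set l₁ := L ^ (-((1 - p) / (2 * (1 + p)))) with hl₁
  set l₂ := L ^ (p / (1 + p)) with hl₂
  have hl : l₁ ≤ l₂ := by
    refine Real.rpow_le_rpow_of_exponent_le hL1 ?_
    have h1 : 0 ≤ (1 - p) / (2 * (1 + p)) := div_nonneg (by linarith [hp.2]) (by positivity)
    have h2 : 0 ≤ p / (1 + p) := by positivity
    linarith
  have hF1 : 2 * ρ ^ 2 / η = √2 * (ρ * (W * l₁)) :=
    RobustTD.two_mul_sq_div_stepSize hu0 hL0 hρ hT
  have hF2 : η * (B ^ 2 * L) = √2 * (ρ * (W * l₁)) :=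
    RobustTD.stepSize_mul_clipRadius_sq hp0 hu0 hL0 hT
  have hF3 : B * L = W * l₂ := RobustTD.clipRadius_mul_logTerm hp0 hu0 hL0 hT
  have hF4 := RobustTD.sum_mul_clipRadius_rpow_neg_le hp hu0 hL0 T
  have hF5 := RobustTD.sum_mul_clipRadius_rpow_div_sq_le hp hu0 hL0 hT
  -- the iterates as a recursion driven by the data
  set Y : ℕ → Ω → EuclideanSpace ℝ (Fin d) :=
    fun n ω => RobustTD.robustTD Φ γ ρ η b (θ₁ ω) (fun n => Z n ω) n with hYdef
  set step : ℕ → EuclideanSpace ℝ (Fin d) → S × ℝ × S → EuclideanSpace ℝ (Fin d) :=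
    fun n θ z => RobustTD.projBall ρ (θ + η • RobustTD.clip (b (n + 1)) (RobustTD.semiGrad Φ γ z θ))
    with hstepdef
  set N : EuclideanSpace ℝ (Fin d) → ℝ := fun θ =>
    ∑ x, μ.real {x} * (RobustTD.valueFun P Q γ x - RobustTD.linApprox Φ θ x) ^ 2 with hN
  have hclipm : ∀ n, Measurable fun q : EuclideanSpace ℝ (Fin d) × (S × ℝ × S) =>
      RobustTD.clip (b (n + 1)) (RobustTD.semiGrad Φ γ q.2 q.1) := fun n =>
    (RobustTD.measurable_clip _).comp (RobustTD.measurable_semiGrad Φ γ)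
  have hstepm : ∀ n, Measurable (Function.uncurry (step n)) := fun n =>
    (RobustTD.measurable_projBall ρ).comp (measurable_fst.add ((hclipm n).const_smul η))
  have hYnorm : ∀ n ω, ‖Y n ω‖ ≤ ρ := fun n ω =>
    RobustTD.norm_robustTD_le Φ γ hρ.le η b (hθ₁ ω) _ n
  have hYstep : ∀ n ω, Y (n + 1) ω = step n (Y n ω) (Z n ω) := fun _ _ => rfl
  have hprob : ∀ n, IsProbabilityMeasure (Pr.map (Z n)) := fun n =>
    Measure.isProbabilityMeasure_map (hZ.measurable_data n).aemeasurable
  have hlawR : ∀ n, (Pr.map (Z n)).map (fun z => (z.1, z.2.1)) = μ ⊗ₘ Q n := fun n => by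
    rw [Measure.map_map (by fun_prop) (hZ.measurable_data n)]
    exact hZ.law_reward n
  have hlawX : ∀ n, (Pr.map (Z n)).map (fun z => (z.1, z.2.2)) = μ ⊗ₘ P := fun n => by
    rw [Measure.map_map (by fun_prop) (hZ.measurable_data n)]
    exact hZ.law_next n
  have hmoment : ∀ n ω, _ := fun n ω =>
    RobustTD.integral_norm_semiGrad_rpow_le hΦ hγ hp hu₀ hρ hQ (hlawR n) (hYnorm n ω)
  rw [← hu] at hmoment
  have hdrift : ∀ n ω, _ := fun n ω =>
    RobustTD.drift_le_integral_inner_semiGrad hγ hp0.le hQ hP.invariant (hlawR n) (hlawX n) hθs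
      (Y n ω)
  have hNint : ∀ θ, ∫ x, (RobustTD.valueFun P Q γ x - RobustTD.linApprox Φ θ x) ^ 2 ∂μ = N θ := by
    intro θ
    rw [integral_fintype Integrable.of_finite]
    simp only [hN, smul_eq_mul]
  -- the two concentration events
  have hev1 := RobustTD.measure_sum_recursion_gt_le (Y := Y) (step := step) (T := T)
    (G := fun n θ z => 1 / (2 * ρ * B) * ((1 - γ) * N θ -
      inner ℝ (RobustTD.clip (b (n + 1)) (RobustTD.semiGrad Φ γ z θ)) (θs - θ)))
    (c := fun n => 9 / 8 * u * b (n + 1) ^ (-p) / B)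
    hZ.measurable_data hZ.indep_data hZ.measurable_init hZ.indep_init hstepm hYstep
    (fun n => by
      have hNm : Measurable N := by
        simp only [hN, RobustTD.linApprox]
        fun_prop
      exact (((hNm.comp measurable_fst).const_mul _).sub
        ((hclipm n).inner (measurable_const.sub measurable_fst))).const_mul _)
    (fun n hn ω => RobustTD.lintegral_exp_inner_clip_le hp (hb0 n) (hbB n hn) hρ
      ((norm_sub_le _ _).trans (by linarith [hYnorm n ω])) (hdrift n ω).1
      (by rw [← hNint]; exact (hdrift n ω).2) (hmoment n ω).1 (hmoment n ω).2)
    (Real.log (2 / δ))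
  have hev2 := RobustTD.measure_sum_recursion_gt_le (Y := Y) (step := step) (T := T)
    (G := fun n θ z => ‖RobustTD.clip (b (n + 1)) (RobustTD.semiGrad Φ γ z θ)‖ ^ 2 / B ^ 2)
    (c := fun n => (Real.exp 1 - 1) * (9 / 8 * u * b (n + 1) ^ (1 - p) / B ^ 2))
    hZ.measurable_data hZ.indep_data hZ.measurable_init hZ.indep_init hstepm hYstep
    (fun n => ((hclipm n).norm.pow_const 2).div_const _)
    (fun n hn ω => RobustTD.lintegral_exp_sq_norm_clip_le hp (hb0 n) (hbB n hn)
      (hmoment n ω).1 (hmoment n ω).2)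
    (Real.log (2 / δ))
  rw [htail] at hev1 hev2
  set bad₁ := {ω | ∑ n ∈ Finset.range T, 9 / 8 * u * b (n + 1) ^ (-p) / B + Real.log (2 / δ) <
    ∑ n ∈ Finset.range T, 1 / (2 * ρ * B) * ((1 - γ) * N (Y n ω) - inner ℝ
      (RobustTD.clip (b (n + 1)) (RobustTD.semiGrad Φ γ (Z n ω) (Y n ω))) (θs - Y n ω))} with hbad₁
  set bad₂ := {ω | ∑ n ∈ Finset.range T,
      (Real.exp 1 - 1) * (9 / 8 * u * b (n + 1) ^ (1 - p) / B ^ 2) + Real.log (2 / δ) <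
    ∑ n ∈ Finset.range T,
      ‖RobustTD.clip (b (n + 1)) (RobustTD.semiGrad Φ γ (Z n ω) (Y n ω))‖ ^ 2 / B ^ 2} with hbad₂
  set good := {ω | N (RobustTD.avgIterate Φ γ ρ η b (θ₁ ω) (fun n => Z n ω) T) ≤
    ρ * u ^ (1 / (1 + p)) / ((1 - γ) * (T : ℝ) ^ (p / (1 + p))) * (3 * l₁ + 7 * l₂)} with hgood
  -- Subadditivity alone bounds the good event from below, so its measurability is not needed.
  suffices hcover : Set.univ ⊆ good ∪ (bad₁ ∪ bad₂) by
    have h1 : (1 : ℝ) ≤ Pr.real good + (Pr.real bad₁ + Pr.real bad₂) := by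
      calc (1 : ℝ) = Pr.real Set.univ := probReal_univ.symm
        _ ≤ Pr.real (good ∪ (bad₁ ∪ bad₂)) := measureReal_mono hcover
        _ ≤ Pr.real good + Pr.real (bad₁ ∪ bad₂) := measureReal_union_le _ _
        _ ≤ _ := by gcongr; exact measureReal_union_le _ _
    change 1 - δ ≤ Pr.real good
    linarith
  intro ω _
  by_contra hω
  simp only [Set.mem_union, not_or] at hω
  obtain ⟨hωg, hω1, hω2⟩ := hω
  refine hωg ?_
  simp only [hbad₁, hbad₂, Set.mem_ofPred_eq, not_lt] at hω1 hω2
  set I := ∑ n ∈ Finset.range T, inner ℝ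
    (RobustTD.clip (b (n + 1)) (RobustTD.semiGrad Φ γ (Z n ω) (Y n ω))) (θs - Y n ω) with hI
  set A := ∑ n ∈ Finset.range T,
    ‖RobustTD.clip (b (n + 1)) (RobustTD.semiGrad Φ γ (Z n ω) (Y n ω))‖ ^ 2 with hA
  set NS := ∑ n ∈ Finset.range T, N (Y n ω) with hNS
  have hregret : I ≤ 2 * ρ ^ 2 / η + η / 2 * A :=
    RobustTD.sum_inner_clip_le Φ γ hρ hη0 b (hθ₁ ω) hθsρ (fun n => Z n ω) T
  -- Undoing the scale `1/(2ρB)`: the moment term gives `2 * (9/8) * 2 = 9/2`, and the confidence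
  -- term gives `2` through `B * L = W * l₂`.
  have hdev : (1 - γ) * NS - I ≤ 13 / 2 * (ρ * (W * l₂)) := by
    have h1 : ∑ n ∈ Finset.range T, 9 / 8 * u * b (n + 1) ^ (-p) / B ≤
        9 / 8 * (2 * (W * l₂)) / B := by
      rw [← Finset.sum_div]
      refine div_le_div_of_nonneg_right ?_ hB0.le
      calc _ = 9 / 8 * ∑ n ∈ Finset.range T, u * b (n + 1) ^ (-p) := by
            rw [Finset.mul_sum]
            exact Finset.sum_congr rfl fun n _ => by ring
        _ ≤ _ := mul_le_mul_of_nonneg_left hF4 (by norm_num)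
    rw [← Finset.mul_sum, Finset.sum_sub_distrib, ← Finset.mul_sum, ← hI, ← hNS] at hω1
    have h2 : 1 / (2 * ρ * B) * ((1 - γ) * NS - I) ≤ 9 / 8 * (2 * (W * l₂)) / B + L := by linarith
    have h3 := mul_le_mul_of_nonneg_left h2 (by positivity : 0 ≤ 2 * ρ * B)
    calc (1 - γ) * NS - I = 2 * ρ * B * (1 / (2 * ρ * B) * ((1 - γ) * NS - I)) := by field_simp
      _ ≤ _ := h3
      _ = 9 / 2 * (ρ * (W * l₂)) + 2 * ρ * (B * L) := by field_simp; ring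
      _ = _ := by rw [hF3]; ring
  have hsq : A ≤ B ^ 2 * L * ((Real.exp 1 - 1) * (9 / 8) + 1) := by
    have he : 0 ≤ Real.exp 1 - 1 := by linarith [Real.add_one_le_exp 1]
    have h1 : ∑ n ∈ Finset.range T, (Real.exp 1 - 1) * (9 / 8 * u * b (n + 1) ^ (1 - p) / B ^ 2) ≤
        (Real.exp 1 - 1) * (9 / 8) * L := by
      calc _ = (Real.exp 1 - 1) * (9 / 8) *
            ∑ n ∈ Finset.range T, u * b (n + 1) ^ (1 - p) / B ^ 2 := by
            rw [Finset.mul_sum]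
            exact Finset.sum_congr rfl fun n _ => by ring
        _ ≤ _ := mul_le_mul_of_nonneg_left hF5 (by positivity)
    rw [← Finset.sum_div, ← hA] at hω2
    have h2 : A / B ^ 2 ≤ L * ((Real.exp 1 - 1) * (9 / 8) + 1) := by linarith
    rw [div_le_iff₀ (by positivity)] at h2
    linarith
  -- The estimates add up to `(7/2) l₁ + (13/2) l₂`; since `l₁ ≤ l₂`, half an `l₁` may be moved to
  -- `l₂`.
  have hNSbound : (1 - γ) * NS ≤ ρ * W * (3 * l₁ + 7 * l₂) := by
    have h1 : η / 2 * A ≤ ((Real.exp 1 - 1) * (9 / 8) + 1) / 2 * √2 * (ρ * (W * l₁)) := by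
      calc η / 2 * A ≤ η / 2 * (B ^ 2 * L * ((Real.exp 1 - 1) * (9 / 8) + 1)) :=
            mul_le_mul_of_nonneg_left hsq (by positivity)
        _ = ((Real.exp 1 - 1) * (9 / 8) + 1) / 2 * (η * (B ^ 2 * L)) := by ring
        _ = _ := by rw [hF2]; ring
    have h2 : 0 < ρ * W := by positivity
    have h3 : 0 < l₁ := by positivity
    have h4 := mul_le_mul_of_nonneg_right RobustTD.sqrt_two_add_le_three_and_half
      (by positivity : 0 ≤ ρ * (W * l₁))
    have h5 := mul_le_mul_of_nonneg_left hl h2.le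
    linarith
  have hjensen : N (RobustTD.avgIterate Φ γ ρ η b (θ₁ ω) (fun n => Z n ω) T) ≤ 1 / (T : ℝ) * NS := by
    calc _ ≤ ∑ x, μ.real {x} * (1 / (T : ℝ) * ∑ n ∈ Finset.range T,
          (RobustTD.valueFun P Q γ x - RobustTD.linApprox Φ (Y n ω) x) ^ 2) :=
          Finset.sum_le_sum fun x _ => mul_le_mul_of_nonneg_left
            (RobustTD.sq_sub_linApprox_average_le Φ _ _ x hT) measureReal_nonneg
      _ = 1 / (T : ℝ) * NS := by
          simp only [hNS, hN]
          rw [Finset.sum_comm, Finset.mul_sum]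
          refine Finset.sum_congr rfl fun x _ => ?_
          rw [← Finset.mul_sum]
          ring
  have hWT : W = u ^ (1 / (1 + p)) * T / (T : ℝ) ^ (p / (1 + p)) := by
    rw [hW, Real.mul_rpow hu0.le hT0.le, mul_div_assoc]
    congr 1
    rw [eq_div_iff (by positivity), ← Real.rpow_add hT0, ← add_div, div_self (by positivity),
      Real.rpow_one]
  refine hjensen.trans ?_
  have h1 : NS ≤ ρ * W * (3 * l₁ + 7 * l₂) / (1 - γ) := by
    rw [le_div_iff₀ hγ1]
    linarith
  calc 1 / (T : ℝ) * NS ≤ 1 / (T : ℝ) * (ρ * W * (3 * l₁ + 7 * l₂) / (1 - γ)) :=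
        mul_le_mul_of_nonneg_left h1 (by positivity)
    _ = _ := by
        rw [hWT]
        field_simp
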